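/- **Theorem 2.** Let $\delta>0$ and let $k\ge 0$ be real, both fixed. For a prime $p$ and $m\ge 0$ put $d_k(p^m)=\frac{k(k+1)\cdots(k+m-1)}{m!}$ (which equals $\Gamma(m+k)/(m!\,\Gamma(k))$ for $k>0$, and is the number of ways to write $p^m$ as an ordered product of $k$ factors when $k$ is an integer), and let $$a_k=\prod_{p}\Big(1-\frac1p\Big)^{k^2}\sum_{m\ge 0}\frac{d_k(p^m)^2}{p^m};$$ the series over $m$ and the product over primes converge. For a Dirichlet character $\chi$ modulo $q$ and a real $X$ let $$P_X(\chi)=\exp\Big(\sum_{2\le n\le X}\frac{\Lambda(n)\chi(n)}{n^{1/2}\log n}\Big),$$ where $\Lambda$ is von Mangoldt's function. Let $\sum^*_{\chi\,(\mathrm{mod}\,q)}$ denote summation over the primitive characters modulo $q$, $\varphi^*(q)$ their number, $\omega(q)$ the number of distinct prime factors of $q$, and $\gamma$ Euler's constant. Let the real parameter $X$ and the integer $q$ tend to infinity, $q$ running through moduli with $\varphi^*(q)>0$ (that is, $q\not\equiv 2 \bmod 4$), in such a way that $X\ll(\log q)^{2-\delta}$. Then $$\frac1{\varphi^*(q)}\sum_{\chi\,(\mathrm{mod}\,q)}^{*}|P_X(\chi)|^{2k}\sim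 a_k\prod_{\substack{p\le X\\ p\mid q}}\Big(\sum_{m\ge0}\frac{d_k(p^m)^2}{p^m}\Big)^{-1}(e^{\gamma}\log X)^{k^2}.$$ If moreover, for every $\varepsilon>0$, $\omega(q)\ll_\varepsilon X^{1+\varepsilon}$, then $$\frac1{\varphi^*(q)}\sum_{\chi\,(\mathrm{mod}\,q)}^{*}|P_X(\chi)|^{2k}\sim a_k\prod_{p\mid q}\Big(\sum_{m\ge0}\frac{d_k(p^m)^2}{p^m}\Big)^{-1}(e^{\gamma}\log X)^{k^2}.$$ -/

import Mathlib

open Filter Asymptotics Topology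

noncomputable section

namespace PrimitiveMoment

/-- The generalized divisor function `d_k` for real `k`: the multiplicative function with
`d_k(p^m) = k (k+1) ⋯ (k+m-1) / m!`. For `k > 0` this is `Γ(m+k) / (m! Γ(k))`, and for a natural
number `k` (including `0`) it is the number of ordered factorizations into `k` factors; see the
two lemmas below. -/
def divisorFn (k : ℝ) (n : ℕ) : ℝ :=
  n.factorization.prod fun _ m => (ascPochhammer ℝ m).eval k / (m.factorial : ℝ)

theorem divisorFn_prime_pow (k : ℝ) {p : ℕ} (hp : p.Prime) (m : ℕ) :
    divisorFn k (p ^ m) = (ascPochhammer ℝ m).eval k / (m.factorial : ℝ) := by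
  rw [divisorFn, hp.factorization_pow, Finsupp.prod_single_index (by simp)]

theorem divisorFn_prime_pow_eq_Gamma {k : ℝ} (hk : 0 < k) {p : ℕ} (hp : p.Prime) (m : ℕ) :
    divisorFn k (p ^ m) = Real.Gamma (m + k) / ((m.factorial : ℝ) * Real.Gamma k) := by
  have h : ∀ m : ℕ, Real.Gamma (m + k) = (ascPochhammer ℝ m).eval k * Real.Gamma k := by
    intro m
    induction m with
    | zero => simp
    | succ m ih =>
      have h0 : (m : ℝ) + k ≠ 0 := by positivity
      have h1 : ((m + 1 : ℕ) : ℝ) + k = (m + k) + 1 := by push_cast; ring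
      rw [h1, Real.Gamma_add_one h0, ih, ascPochhammer_succ_eval]
      ring
  have hG : Real.Gamma k ≠ 0 := (Real.Gamma_pos_of_pos hk).ne'
  rw [divisorFn_prime_pow k hp, h]
  field_simp

theorem divisorFn_prime_pow_natCast (k : ℕ) {p : ℕ} (hp : p.Prime) (m : ℕ) :
    divisorFn k (p ^ m) = (Nat.finMulAntidiag k (p ^ m)).card := by
  have hcard : (Nat.finMulAntidiag k (p ^ m)).card = (k + m - 1).choose m := by
    have h1 : Nat.finMulAntidiag k (p ^ m) =
        (Finset.finsuppAntidiag (Finset.univ : Finset (Fin k)) m).image fun f i => p ^ f i := by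
      ext f
      simp only [Nat.mem_finMulAntidiag, Finset.mem_image, Finset.mem_finsuppAntidiag]
      constructor
      · rintro ⟨hf, -⟩
        have h2 : ∀ i, ∃ e, f i = p ^ e := fun i => by
          have : f i ∣ p ^ m := hf ▸ Finset.dvd_prod_of_mem f (Finset.mem_univ i)
          obtain ⟨e, -, he⟩ := (Nat.dvd_prime_pow hp).1 this
          exact ⟨e, he⟩
        choose e he using h2
        refine ⟨Finsupp.equivFunOnFinite.symm e, ⟨?_, by simp⟩, (funext he).symm⟩
        simp only [he, Finset.prod_pow_eq_pow_sum] at hf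
        exact Nat.pow_right_injective hp.two_le hf
      · rintro ⟨e, ⟨he, -⟩, rfl⟩
        exact ⟨by rw [Finset.prod_pow_eq_pow_sum, he], pow_ne_zero _ hp.ne_zero⟩
    have hinj : Function.Injective fun (f : Fin k →₀ ℕ) i => p ^ f i := fun f g h =>
      Finsupp.ext fun i => Nat.pow_right_injective hp.two_le (congrFun h i)
    rw [h1, Finset.card_image_of_injective _ hinj, Finset.card_finsuppAntidiag_nat_eq_choose]
    simp
  rw [divisorFn_prime_pow _ hp, hcard, ascPochhammer_nat_eq_natCast_ascFactorial,
    Nat.ascFactorial_eq_factorial_mul_choose', div_eq_iff (by positivity)]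
  push_cast
  ring

/-- The local series `∑_{m ≥ 0} d_k(p^m)² / p^m`. -/
def localSum (k : ℝ) (p : ℕ) : ℝ :=
  ∑' m : ℕ, divisorFn k (p ^ m) ^ 2 / (p : ℝ) ^ m

/-- The arithmetic constant `a_k = ∏_p (1 - 1/p)^{k²} ∑_{m ≥ 0} d_k(p^m)² / p^m`. -/
def arithConst (k : ℝ) : ℝ :=
  ∏' p : Nat.Primes, (1 - 1 / ((p : ℕ) : ℝ)) ^ (k ^ 2) * localSum k p

/-- The truncated Euler product `P_X(χ) = exp (∑_{n ≤ X} Λ(n) χ(n) / (n^{1/2} log n))`.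
The term `n = 1` is `0`, because `Λ(1) = 0`. -/
def eulerP {q : ℕ} (X : ℝ) (χ : DirichletCharacter ℂ q) : ℂ :=
  Complex.exp (∑ n ∈ Finset.Icc 1 ⌊X⌋₊,
    (ArithmeticFunction.vonMangoldt n : ℂ) * χ (n : ZMod q) /
      ((Real.sqrt n : ℂ) * (Real.log n : ℂ)))

/-- The finite set of primitive Dirichlet characters modulo `q`. -/
def primitiveChars (q : ℕ) : Finset (DirichletCharacter ℂ q) :=
  (Set.toFinite {χ : DirichletCharacter ℂ q | χ.IsPrimitive}).toFinset

/-- `φ*(q)`, the number of primitive Dirichlet characters modulo `q`. -/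
def phiStar (q : ℕ) : ℕ := (primitiveChars q).card

/-- The average of `|P_X(χ)|^{2k}` over the primitive characters modulo `q`. -/
def moment (k X : ℝ) (q : ℕ) : ℝ :=
  1 / (phiStar q : ℝ) * ∑ χ ∈ primitiveChars q, ‖eulerP X χ‖ ^ (2 * k)

end PrimitiveMoment

end

noncomputable section

namespace PrimitiveMoment

/-! ### Mertens' theorems -/

/-! Write N = ⌊X⌋. Since log P_X(χ) is a finite sum over prime powers up to N, the k-th power of
P_X(χ) factors over the primes p ≤ N into entire functions exp(k(z + z²/2 + ⋯ + z^M/M)) of z =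
χ(p)/√p, with p^M the largest power of p up to N. Multiplying out their Taylor series gives an
absolutely convergent series ∑ c(n) χ(n)/√n over integers n all of whose prime factors are at most
N, with c ≥ 0 multiplicative (`summable_and_hasSum_smoothCoeff`). Hence the moment is a double sum
over m, n weighted by the average of χ(m) times the conjugate of χ(n) over primitive χ.

The diagonal m = n is an Euler product over p ≤ N with p ∤ q (`hasSum_smoothCoeff_sq`). Off the
diagonal, Möbius inversion over conductors bounds the character sum by mn, whatever q is
(`norm_primSum_le_mul`), and trivially it is at most φ*(q). Interpolating, it is at most φ*(q)^(1-η)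
(mn)^η, so by Rankin's trick the off-diagonal part is at most φ*(q)^(-η) exp(4k X^(1/2+η))
(`abs_moment_sub_diagonalProd_le`, `sum_vonMangoldt_rpow_le`). As φ*(q)² ≥ q/12 when φ*(q) > 0
(`le_twelve_mul_phiStar_sq`), and X ≪ (log q)^(2-δ), this tends to 0 for small η, while the diagonal
is at least 1.

In the diagonal, c(p^m) = d_k(p^m) for m ≤ M and 0 ≤ c(p^m) ≤ d_k(p^m) beyond; dominated convergence
over p lets each truncated factor be replaced by the full local series
(`tendsto_sum_localSum_sub_truncLocalSum`). Mertens' third theorem evaluates the product of these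
series over p ≤ X (`tendsto_prod_localSum_div`). If ω(q) ≪ X^(1+ε) for every ε, the primes p > X
dividing q contribute a factor tending to 1: those up to X^(1+2ε) are controlled by Mertens, the
larger ones by their number (`tendsto_sum_mertensWeight_large`).

Mertens' third theorem is proved with its constant. Factorials and Dirichlet's test give a limit C
for the sum minus log log; Abel's theorem, applied to a power series in e^(-σ) compared with log
ζ(1+σ), forces C = γ. -/

theorem log_factorial_eq_sum (N : ℕ) :
    Real.log (N.factorial) =
      ∑ p ∈ N.primesLE, ((N.factorial).factorization p : ℝ) * Real.log p := by
  rw [Real.log_nat_eq_sum_factorization]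
  refine Finsupp.sum_of_support_subset _ ?_ _ (by simp)
  intro p hp
  rw [Nat.support_factorization, Nat.mem_primeFactors] at hp
  exact Nat.mem_primesLE.2 ⟨(hp.1.dvd_factorial).1 hp.2.1, hp.1⟩

theorem div_sub_one_le_factorization_factorial {p : ℕ} (hp : p.Prime) (N : ℕ) :
    (N : ℝ) / p - 1 ≤ (N.factorial).factorization p := by
  have h : N / p ≤ (N.factorial).factorization p := by
    rw [Nat.factorization_factorial hp (lt_of_lt_of_le (Nat.lt_succ_self _)
      (Nat.le_add_right _ 1) : Nat.log p N < Nat.log p N + 1 + 1)]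
    have := Finset.single_le_sum (f := fun i => N / p ^ i) (fun _ _ => Nat.zero_le _)
      (Finset.mem_Ico.2 ⟨le_refl 1, by omega⟩ : 1 ∈ Finset.Ico 1 (Nat.log p N + 1 + 1))
    simpa using this
  have h2 := Nat.lt_floor_add_one ((N : ℝ) / p)
  rw [Nat.floor_div_eq_div] at h2
  have h3 : ((N / p : ℕ) : ℝ) ≤ (N.factorial).factorization p := by exact_mod_cast h
  linarith

theorem factorization_factorial_le_div {p : ℕ} (hp : p.Prime) (N : ℕ) :
    ((N.factorial).factorization p : ℝ) ≤ N / (p - 1) := by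
  have := Fact.mk hp
  have h := sub_one_mul_padicValNat_factorial (p := p) N
  rw [← Nat.factorization_def _ hp] at h
  have h1 : (p - 1) * (N.factorial).factorization p ≤ N := h ▸ Nat.sub_le _ _
  have h2 : (1 : ℝ) < p := by exact_mod_cast hp.one_lt
  rw [le_div_iff₀ (by linarith)]
  have h3 : (((p - 1) * (N.factorial).factorization p : ℕ) : ℝ) ≤ N := by exact_mod_cast h1
  rw [Nat.cast_mul, Nat.cast_sub hp.one_le] at h3
  push_cast at h3
  linarith

/-- Insert v_p(N!) ≥ N/p - 1 into log N! ≤ N log N. The loss from the -1 is θ(N), which Chebyshev's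
bound N log 4 absorbs. -/
theorem sum_log_div_le {N : ℕ} (hN : 1 ≤ N) :
    ∑ p ∈ N.primesLE, Real.log p / p ≤ Real.log N + Real.log 4 := by
  have hN0 : (0 : ℝ) < N := by exact_mod_cast hN
  have h1 : Real.log (N.factorial) ≤ N * Real.log N := by
    rw [← Real.log_pow]
    apply Real.log_le_log (by positivity)
    exact_mod_cast Nat.factorial_le_pow N
  have h2 : ∑ p ∈ N.primesLE, ((N : ℝ) / p - 1) * Real.log p ≤ Real.log (N.factorial) := by
    rw [log_factorial_eq_sum]
    refine Finset.sum_le_sum fun p hp => ?_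
    exact mul_le_mul_of_nonneg_right
      (div_sub_one_le_factorization_factorial (Nat.prime_of_mem_primesLE hp) N)
      (Real.log_natCast_nonneg p)
  have h3 := Chebyshev.theta_le_log4_mul_x hN0.le
  rw [Chebyshev.theta_eq_sum_primesLE_log] at h3
  have h4 : ∑ p ∈ N.primesLE, ((N : ℝ) / p - 1) * Real.log p
      = N * ∑ p ∈ N.primesLE, Real.log p / p - ∑ p ∈ N.primesLE, Real.log p := by
    rw [Finset.mul_sum, ← Finset.sum_sub_distrib]
    exact Finset.sum_congr rfl fun p _ => by ring
  rw [h4] at h2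
  refine le_of_mul_le_mul_left ?_ hN0
  linarith

/-- Legendre's formula gives v_p(N!) ≤ N/(p-1), and N^N/N! ≤ e^N gives log N! ≥ N log N - N. -/
theorem le_sum_log_div_sub_one {N : ℕ} (hN : 1 ≤ N) :
    Real.log N - 1 ≤ ∑ p ∈ N.primesLE, Real.log p / ((p : ℝ) - 1) := by
  have hN0 : (0 : ℝ) < N := by exact_mod_cast hN
  have h1 : N * Real.log N - N ≤ Real.log (N.factorial) := by
    have h := Real.pow_div_factorial_le_exp (N : ℝ) hN0.le N
    have h' := Real.log_le_log (by positivity) h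
    rw [Real.log_exp, Real.log_div (by positivity) (by positivity), Real.log_pow] at h'
    linarith
  have h2 : Real.log (N.factorial) ≤ N * ∑ p ∈ N.primesLE, Real.log p / ((p : ℝ) - 1) := by
    rw [log_factorial_eq_sum, Finset.mul_sum]
    refine Finset.sum_le_sum fun p hp => ?_
    have := mul_le_mul_of_nonneg_right
      (factorization_factorial_le_div (Nat.prime_of_mem_primesLE hp) N)
      (Real.log_natCast_nonneg p)
    refine this.trans (le_of_eq ?_)
    ring
  refine le_of_mul_le_mul_left ?_ hN0
  linarith

theorem summable_log_div_mul_sub_one :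
    Summable fun n : ℕ => Real.log n / ((n : ℝ) * (n - 1)) := by
  -- For n ≥ 2, log n ≤ 2√n and n - 1 ≥ n/2, whence the factor 4; the terms n = 0, 1 vanish.
  have hs : Summable fun n : ℕ => 4 * (1 / (n : ℝ) ^ (3 / 2 : ℝ)) :=
    (Real.summable_one_div_nat_rpow.2 (by norm_num)).mul_left 4
  refine Summable.of_nonneg_of_le (fun n => ?_) (fun n => ?_) hs
  · rcases n with _ | n
    · simp
    · have : (0 : ℝ) ≤ ((n + 1 : ℕ) : ℝ) - 1 := by push_cast; linarith [n.cast_nonneg (α := ℝ)]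
      have := Real.log_natCast_nonneg (n + 1)
      positivity
  · rcases n with _ | _ | n
    · simp
    · simp
    · set x : ℝ := ((n + 1 + 1 : ℕ) : ℝ) with hx
      have hx2 : 2 ≤ x := by rw [hx]; push_cast; linarith [n.cast_nonneg (α := ℝ)]
      have h1 : Real.log x ≤ x ^ (1 / 2 : ℝ) / (1 / 2) :=
        Real.log_le_rpow_div (by linarith) (by norm_num)
      have h2 : x ^ (3 / 2 : ℝ) * x ^ (1 / 2 : ℝ) = x * x := by
        rw [← Real.rpow_add (by linarith)]; norm_num; ring
      have h0 : 0 < x ^ (3 / 2 : ℝ) := by positivity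
      rw [mul_one_div, div_le_div_iff₀ (by nlinarith) h0]
      calc Real.log x * x ^ (3 / 2 : ℝ) ≤ x ^ (1 / 2 : ℝ) / (1 / 2) * x ^ (3 / 2 : ℝ) := by gcongr
        _ = 2 * (x * x) := by rw [← h2]; ring
        _ ≤ 4 * (x * (x - 1)) := by nlinarith

/-- The weight `-log (1 - 1/p)` supported on the primes. -/
def mertensWeight (n : ℕ) : ℝ := if n.Prime then -Real.log (1 - 1 / (n : ℝ)) else 0

theorem le_neg_log_one_sub {x : ℝ} (hx : x < 1) : x ≤ -Real.log (1 - x) := by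
  have := Real.log_le_sub_one_of_pos (by linarith : 0 < 1 - x)
  linarith

theorem neg_log_one_sub_le {x : ℝ} (hx : x < 1) : -Real.log (1 - x) ≤ x / (1 - x) := by
  have h := Real.one_sub_inv_le_log_of_pos (by linarith : 0 < 1 - x)
  have : x / (1 - x) = (1 - x)⁻¹ - 1 := by
    have : 1 - x ≠ 0 := by linarith
    field_simp; ring
  linarith

theorem neg_log_one_sub_le_add_sq {x : ℝ} (hx : x ≤ 1 / 2) :
    -Real.log (1 - x) ≤ x + 2 * x ^ 2 := by
  refine (neg_log_one_sub_le (by linarith)).trans ?_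
  rw [div_le_iff₀ (by linarith)]
  nlinarith [mul_nonneg (sq_nonneg x) (by linarith : (0 : ℝ) ≤ 1 - 2 * x)]

theorem one_div_prime_le_half {p : ℕ} (hp : p.Prime) : 1 / (p : ℝ) ≤ 1 / 2 := by
  have : (2 : ℝ) ≤ p := by exact_mod_cast hp.two_le
  gcongr

theorem mertensWeight_nonneg (n : ℕ) : 0 ≤ mertensWeight n := by
  unfold mertensWeight
  split_ifs with h
  · exact le_trans (by positivity) (le_neg_log_one_sub (by linarith [one_div_prime_le_half h]))
  · rfl

/-- Mertens' first theorem: the weight lies between 1/p and 1/(p-1), and the two resulting sums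
differ by part of the convergent series ∑ log n / (n(n-1)). -/
theorem exists_abs_sum_mertensWeight_mul_log_sub_log_le :
    ∃ B : ℝ, ∀ N : ℕ, 1 ≤ N →
      |∑ p ∈ N.primesLE, mertensWeight p * Real.log p - Real.log N| ≤ B := by
  have hnn : ∀ p : ℕ, 0 ≤ Real.log p / ((p : ℝ) * (p - 1)) := by
    rintro (_ | n)
    · simp
    · have : (0 : ℝ) ≤ ((n + 1 : ℕ) : ℝ) - 1 := by push_cast; linarith [n.cast_nonneg (α := ℝ)]
      have := Real.log_natCast_nonneg (n + 1)
      positivity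
  set K := ∑' n : ℕ, Real.log n / ((n : ℝ) * (n - 1)) with hK
  have hK0 : 0 ≤ K := tsum_nonneg hnn
  refine ⟨Real.log 4 + 1 + K, fun N hN => ?_⟩
  have hle : ∑ p ∈ N.primesLE, Real.log p / ((p : ℝ) * (p - 1)) ≤ K :=
    summable_log_div_mul_sub_one.sum_le_tsum _ fun p _ => hnn p
  have key : ∀ p ∈ N.primesLE, Real.log p / ((p : ℝ) - 1) =
      Real.log p / p + Real.log p / ((p : ℝ) * (p - 1)) := by
    intro p hp
    have : (2 : ℝ) ≤ p := by exact_mod_cast Nat.two_le_of_mem_primesLE hp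
    have h1 : (p : ℝ) - 1 ≠ 0 := by linarith
    have h2 : (p : ℝ) ≠ 0 := by linarith
    field_simp; ring
  have hsum : ∑ p ∈ N.primesLE, Real.log p / ((p : ℝ) - 1) =
      ∑ p ∈ N.primesLE, Real.log p / p + ∑ p ∈ N.primesLE, Real.log p / ((p : ℝ) * (p - 1)) := by
    rw [← Finset.sum_add_distrib]; exact Finset.sum_congr rfl key
  have hup : ∑ p ∈ N.primesLE, mertensWeight p * Real.log p ≤
      ∑ p ∈ N.primesLE, Real.log p / ((p : ℝ) - 1) := by
    refine Finset.sum_le_sum fun p hp => ?_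
    have hp' := Nat.prime_of_mem_primesLE hp
    have h2 : (2 : ℝ) ≤ p := by exact_mod_cast hp'.two_le
    rw [mertensWeight, if_pos hp', div_eq_inv_mul (Real.log p)]
    refine mul_le_mul_of_nonneg_right ?_ (Real.log_natCast_nonneg p)
    refine (neg_log_one_sub_le (by linarith [one_div_prime_le_half hp'])).trans (le_of_eq ?_)
    have h1 : (p : ℝ) - 1 ≠ 0 := by linarith
    field_simp
  have hlo : ∑ p ∈ N.primesLE, Real.log p / p ≤
      ∑ p ∈ N.primesLE, mertensWeight p * Real.log p := by
    refine Finset.sum_le_sum fun p hp => ?_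
    have hp' := Nat.prime_of_mem_primesLE hp
    rw [mertensWeight, if_pos hp', div_eq_inv_mul (Real.log p), ← one_div]
    exact mul_le_mul_of_nonneg_right
      (le_neg_log_one_sub (by linarith [one_div_prime_le_half hp'])) (Real.log_natCast_nonneg p)
  have h1 := sum_log_div_le hN
  have h2 := le_sum_log_div_sub_one hN
  have h4 : 0 ≤ Real.log 4 := Real.log_nonneg (by norm_num)
  rw [abs_le]
  constructor <;> linarith

/-! ### Convergence of the Mertens sum -/

theorem sum_primesLE_eq_sum_range (f : ℕ → ℝ) (n : ℕ) :
    ∑ p ∈ (n + 1).primesLE, mertensWeight p * f p =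
      ∑ i ∈ Finset.range n, mertensWeight (i + 2) * f (i + 2) := by
  rw [Nat.primesLE_eq_filter_range, Finset.sum_filter, Finset.sum_range_succ', Finset.sum_range_succ']
  simp only [Nat.not_prime_zero, if_false, add_zero, zero_add, Nat.not_prime_one]
  refine Finset.sum_congr rfl fun i _ => ?_
  split_ifs with h
  · rfl
  · rw [mertensWeight, if_neg h, zero_mul]

/-- This is the error in replacing an increment of log log by (increment of log)/log. With a ≤ b the
two logarithms, each term lies between 0 and (1/a - 1/b)(b - a), and b - a ≤ 1, so the bound
telescopes. -/
theorem summable_log_log_sub :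
    Summable fun i : ℕ => Real.log (Real.log ((i : ℝ) + 2)) - Real.log (Real.log ((i : ℝ) + 1)) -
      (Real.log ((i : ℝ) + 2) - Real.log ((i : ℝ) + 1)) / Real.log ((i : ℝ) + 2) := by
  -- The term i = 0 involves log (log 1) = log 0 and is set aside.
  rw [← summable_nat_add_iff 1]
  have hpos : ∀ i : ℕ, 0 < Real.log ((i : ℝ) + 2) := fun i =>
    Real.log_pos (by linarith [i.cast_nonneg (α := ℝ)])
  have hmono : ∀ i : ℕ, Real.log ((i : ℝ) + 2) ≤ Real.log ((i : ℝ) + 3) := fun i =>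
    Real.log_le_log (by positivity) (by linarith)
  have hstep : ∀ i : ℕ, Real.log ((i : ℝ) + 3) - Real.log ((i : ℝ) + 2) ≤ 1 := fun i => by
    have hi := i.cast_nonneg (α := ℝ)
    rw [← Real.log_div (by positivity) (by positivity)]
    refine (Real.log_le_sub_one_of_pos (by positivity)).trans ?_
    rw [sub_le_iff_le_add, div_le_iff₀ (by positivity)]
    linarith
  have e : ∀ i : ℕ, ((i + 1 : ℕ) : ℝ) + 2 = (i : ℝ) + 3 ∧ ((i + 1 : ℕ) : ℝ) + 1 = (i : ℝ) + 2 :=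
    fun i => by push_cast; constructor <;> ring
  simp only [(e _).1, (e _).2]
  have hb : ∀ i : ℕ, 0 ≤ Real.log (Real.log ((i : ℝ) + 3)) - Real.log (Real.log ((i : ℝ) + 2)) -
      (Real.log ((i : ℝ) + 3) - Real.log ((i : ℝ) + 2)) / Real.log ((i : ℝ) + 3) ∧
      Real.log (Real.log ((i : ℝ) + 3)) - Real.log (Real.log ((i : ℝ) + 2)) -
      (Real.log ((i : ℝ) + 3) - Real.log ((i : ℝ) + 2)) / Real.log ((i : ℝ) + 3) ≤
      1 / Real.log ((i : ℝ) + 2) - 1 / Real.log ((i : ℝ) + 3) := by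
    intro i
    have ha := hpos i
    have hab := hmono i
    have hd := hstep i
    set a := Real.log ((i : ℝ) + 2)
    set b := Real.log ((i : ℝ) + 3)
    have hb : 0 < b := ha.trans_le hab
    rw [← Real.log_div hb.ne' ha.ne']
    have h1 := Real.one_sub_inv_le_log_of_pos (div_pos hb ha)
    have h2 := Real.log_le_sub_one_of_pos (div_pos hb ha)
    have e1 : 1 - (b / a)⁻¹ = (b - a) / b := by field_simp
    have e2 : b / a - 1 - (b - a) / b = (1 / a - 1 / b) * (b - a) := by field_simp
    have e3 : 0 ≤ 1 / a - 1 / b := by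
      have := one_div_le_one_div_of_le ha hab; linarith
    constructor
    · linarith
    · nlinarith
  refine summable_of_sum_range_le (c := 1 / Real.log 2) (fun i => (hb i).1) fun n => ?_
  refine (Finset.sum_le_sum fun i _ => (hb i).2).trans ?_
  have ht := Finset.sum_range_sub' (fun i : ℕ => 1 / Real.log ((i : ℝ) + 2)) n
  have e' : ∀ i : ℕ, ((i + 1 : ℕ) : ℝ) + 2 = (i : ℝ) + 3 := fun i => (e i).1
  simp only [e'] at ht
  rw [ht]
  have := hpos n
  simp only [Nat.cast_zero, zero_add]
  have : 0 ≤ 1 / Real.log ((n : ℝ) + 2) := by positivity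
  linarith

/-- Dirichlet's test: the terms w(n) log n - (log n - log (n-1)), with w the Mertens weight, have
bounded partial sums by Mertens' first theorem, and 1/log n decreases to 0. What remains is the
convergent series of `summable_log_log_sub`. -/
theorem exists_tendsto_sum_mertensWeight_sub_log_log :
    ∃ C : ℝ, Tendsto (fun N : ℕ => ∑ p ∈ N.primesLE, mertensWeight p - Real.log (Real.log N))
      atTop (𝓝 C) := by
  obtain ⟨B, hB⟩ := exists_abs_sum_mertensWeight_mul_log_sub_log_le
  set z : ℕ → ℝ := fun i => mertensWeight (i + 2) * Real.log ((i : ℝ) + 2) -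
    (Real.log ((i : ℝ) + 2) - Real.log ((i : ℝ) + 1)) with hz
  have hpos : ∀ i : ℕ, 0 < Real.log ((i : ℝ) + 2) := fun i =>
    Real.log_pos (by linarith [i.cast_nonneg (α := ℝ)])
  have hzb : ∀ n, ‖∑ i ∈ Finset.range n, z i‖ ≤ B := by
    intro n
    have h := hB (n + 1) (by omega)
    rw [sum_primesLE_eq_sum_range (fun p => Real.log p)] at h
    have ht := Finset.sum_range_sub (fun i : ℕ => Real.log ((i : ℝ) + 1)) n
    rw [Real.norm_eq_abs, hz, Finset.sum_sub_distrib]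
    have e : ∀ i : ℕ, ((i + 1 : ℕ) : ℝ) + 1 = (i : ℝ) + 2 := fun i => by push_cast; ring
    simp only [e, Nat.cast_zero, zero_add, Real.log_one, sub_zero] at ht
    rw [ht]
    simpa using h
  have hanti : Antitone fun i : ℕ => 1 / Real.log ((i : ℝ) + 2) := by
    intro i j hij
    have : (i : ℝ) ≤ j := by exact_mod_cast hij
    exact one_div_le_one_div_of_le (hpos i) (Real.log_le_log (by positivity) (by linarith))
  have hlim : Tendsto (fun i : ℕ => 1 / Real.log ((i : ℝ) + 2)) atTop (𝓝 0) := by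
    simp only [one_div]
    refine tendsto_inv_atTop_zero.comp (Real.tendsto_log_atTop.comp ?_)
    exact tendsto_atTop_add_const_right _ _ tendsto_natCast_atTop_atTop
  obtain ⟨C₁, hC₁⟩ := cauchySeq_tendsto_of_complete
    (hanti.cauchySeq_series_mul_of_tendsto_zero_of_bounded hlim hzb)
  have hC₂ := summable_log_log_sub.hasSum.tendsto_sum_nat
  set C₂ := ∑' i : ℕ, (Real.log (Real.log ((i : ℝ) + 2)) - Real.log (Real.log ((i : ℝ) + 1)) -
      (Real.log ((i : ℝ) + 2) - Real.log ((i : ℝ) + 1)) / Real.log ((i : ℝ) + 2))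
  refine ⟨C₁ - C₂, ?_⟩
  rw [← tendsto_add_atTop_iff_nat 1]
  refine (hC₁.sub hC₂).congr fun n => ?_
  rw [← Finset.sum_sub_distrib]
  have h1 := sum_primesLE_eq_sum_range (fun _ => 1) n
  simp only [mul_one] at h1
  rw [h1]
  have ht := Finset.sum_range_sub (fun i : ℕ => Real.log (Real.log ((i : ℝ) + 1))) n
  have e : ∀ i : ℕ, ((i + 1 : ℕ) : ℝ) + 1 = (i : ℝ) + 2 := fun i => by push_cast; ring
  -- The telescoping sum starts at log (log 1), which is 0 by the convention log 0 = 0.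
  simp only [e, Nat.cast_zero, zero_add, Real.log_one, Real.log_zero, sub_zero] at ht
  push_cast
  rw [← ht, ← Finset.sum_sub_distrib]
  refine Finset.sum_congr rfl fun i _ => ?_
  have := (hpos i).ne'
  simp only [hz, smul_eq_mul]
  field_simp
  ring

theorem tendsto_log_log_floor_sub :
    Tendsto (fun x : ℝ => Real.log (Real.log (⌊x⌋₊ : ℝ)) - Real.log (Real.log x)) atTop (𝓝 0) := by
  have h1 : Tendsto (fun x : ℝ => Real.log ((⌊x⌋₊ : ℝ) / x)) atTop (𝓝 0) := by
    have := (tendsto_nat_floor_div_atTop (R := ℝ)).log one_ne_zero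
    rwa [Real.log_one] at this
  have h2 : Tendsto (fun x : ℝ => 1 + Real.log ((⌊x⌋₊ : ℝ) / x) * (Real.log x)⁻¹) atTop (𝓝 1) := by
    have := (h1.mul (tendsto_inv_atTop_zero.comp Real.tendsto_log_atTop)).const_add 1
    simpa using this
  have h3 := h2.log one_ne_zero
  rw [Real.log_one] at h3
  refine h3.congr' ?_
  filter_upwards [eventually_ge_atTop 2] with x hx
  have hf : 2 ≤ ⌊x⌋₊ := Nat.le_floor (by exact_mod_cast hx)
  have hf' : (2 : ℝ) ≤ ⌊x⌋₊ := by exact_mod_cast hf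
  have l1 : 0 < Real.log x := Real.log_pos (by linarith)
  have l2 : 0 < Real.log ⌊x⌋₊ := Real.log_pos (by linarith)
  rw [← Real.log_div l2.ne' l1.ne', Real.log_div (by linarith) (by linarith)]
  congr 1
  field_simp
  ring

/-- The logarithm `-log (1 - p^{-s})` of the Euler factor of `ζ` at `p`, extended by zero. -/
def logEulerFactor (s : ℝ) (n : ℕ) : ℝ :=
  if n.Prime then -Real.log (1 - (n : ℝ) ^ (-s)) else 0

/-! ### The Euler product of ζ near s = 1 -/

theorem prime_rpow_neg_le {p : ℕ} (hp : p.Prime) {s : ℝ} (hs : 1 ≤ s) :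
    (p : ℝ) ^ (-s) ≤ 1 / p := by
  have h1 : (1 : ℝ) ≤ p := by exact_mod_cast hp.one_le
  rw [one_div, ← Real.rpow_neg_one]
  exact Real.rpow_le_rpow_of_exponent_le h1 (by linarith)

theorem logEulerFactor_bounds {p : ℕ} (hp : p.Prime) {s : ℝ} (hs : 1 ≤ s) :
    (p : ℝ) ^ (-s) ≤ logEulerFactor s p ∧
      logEulerFactor s p ≤ (p : ℝ) ^ (-s) + 2 * (1 / (p : ℝ) ^ 2) := by
  have h0 : (0 : ℝ) ≤ (p : ℝ) ^ (-s) := by positivity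
  have h1 := prime_rpow_neg_le hp hs
  have h2 := one_div_prime_le_half hp
  rw [logEulerFactor, if_pos hp]
  refine ⟨le_neg_log_one_sub (by linarith), (neg_log_one_sub_le_add_sq (by linarith)).trans ?_⟩
  have : ((p : ℝ) ^ (-s)) ^ 2 ≤ (1 / (p : ℝ)) ^ 2 := pow_le_pow_left₀ h0 h1 2
  rw [div_pow, one_pow] at this
  linarith

theorem mertensWeight_eq_logEulerFactor : mertensWeight = logEulerFactor 1 := by
  funext n
  simp only [mertensWeight, logEulerFactor, Real.rpow_neg_one, one_div]

theorem logEulerFactor_nonneg {s : ℝ} (hs : 1 ≤ s) (n : ℕ) : 0 ≤ logEulerFactor s n := by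
  by_cases h : n.Prime
  · exact le_trans (by positivity) (logEulerFactor_bounds h hs).1
  · rw [logEulerFactor, if_neg h]

theorem logEulerFactor_le {s : ℝ} (hs : 1 ≤ s) (n : ℕ) :
    logEulerFactor s n ≤ (n : ℝ) ^ (-s) + 2 * (1 / (n : ℝ) ^ 2) := by
  by_cases h : n.Prime
  · exact (logEulerFactor_bounds h hs).2
  · rw [logEulerFactor, if_neg h]; positivity

theorem summable_one_div_nat_sq : Summable fun n : ℕ => 1 / (n : ℝ) ^ 2 :=
  Real.summable_one_div_nat_pow.2 one_lt_two

theorem summable_nat_rpow_neg {s : ℝ} (hs : 1 < s) : Summable fun n : ℕ => (n : ℝ) ^ (-s) :=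
  Real.summable_nat_rpow.2 (by linarith)

theorem summable_logEulerFactor {s : ℝ} (hs : 1 < s) : Summable (logEulerFactor s) :=
  Summable.of_nonneg_of_le (logEulerFactor_nonneg hs.le) (logEulerFactor_le hs.le)
    ((summable_nat_rpow_neg hs).add (summable_one_div_nat_sq.mul_left 2))

theorem exp_tsum_logEulerFactor {s : ℝ} (hs : 1 < s) :
    Real.exp (∑' n, logEulerFactor s n) = ∑' n : ℕ, 1 / (n : ℝ) ^ s := by
  let f : ℕ →*₀ ℝ :=
    { toFun := fun n => (n : ℝ) ^ (-s)
      map_zero' := by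
        rw [Nat.cast_zero, Real.zero_rpow (by linarith)]
      map_one' := by simp
      map_mul' := fun m n => by
        rw [Nat.cast_mul, Real.mul_rpow m.cast_nonneg n.cast_nonneg] }
  have hf : ∀ n : ℕ, f n = (n : ℝ) ^ (-s) := fun _ => rfl
  have hsum : Summable fun n => ‖f n‖ := by
    simpa only [hf] using! (summable_nat_rpow_neg hs).norm
  have h := EulerProduct.eulerProduct_completely_multiplicative_hasProd hsum
  let F : ℕ → ℝ := fun n => (1 - f n)⁻¹
  have h' : HasProd (Set.mulIndicator {p | Nat.Prime p} F) (∑' n, f n) :=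
    hasProd_subtype_iff_mulIndicator.1 h
  have hlog : ∀ n, Real.log (Set.mulIndicator {p | Nat.Prime p} F n) = logEulerFactor s n := by
    intro n
    by_cases hn : n.Prime
    · rw [Set.mulIndicator_of_mem (show n ∈ {p | Nat.Prime p} from hn), logEulerFactor, if_pos hn,
        Real.log_inv, hf]
    · rw [Set.mulIndicator_of_notMem (show n ∉ {p | Nat.Prime p} from hn), logEulerFactor,
        if_neg hn, Real.log_one]
  have hpos : ∀ n, 0 < Set.mulIndicator {p | Nat.Prime p} F n := by
    intro n
    by_cases hn : n.Prime
    · rw [Set.mulIndicator_of_mem (show n ∈ {p | Nat.Prime p} from hn)]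
      have := prime_rpow_neg_le hn hs.le
      have := one_div_prime_le_half hn
      exact inv_pos.2 (by rw [hf]; linarith)
    · rw [Set.mulIndicator_of_notMem (show n ∉ {p | Nat.Prime p} from hn)]
      exact one_pos
  have hexp := Real.rexp_tsum_eq_tprod hpos (by simpa only [hlog] using summable_logEulerFactor hs)
  simp only [hlog] at hexp
  rw [hexp, h'.tprod_eq]
  refine tsum_congr fun n => ?_
  rw [hf, Real.rpow_neg n.cast_nonneg, one_div]

/-- The sum is log ζ(1+σ), and σ ζ(1+σ) → 1 by the simple pole at 1. -/
theorem tendsto_tsum_logEulerFactor_add_log :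
    Tendsto (fun σ : ℝ => ∑' n, logEulerFactor (1 + σ) n + Real.log σ) (𝓝[>] 0) (𝓝 0) := by
  have hshift : Tendsto (fun σ : ℝ => 1 + σ) (𝓝[>] 0) (𝓝[>] 1) := by
    refine tendsto_nhdsWithin_iff.2 ⟨?_, ?_⟩
    · have : Tendsto (fun σ : ℝ => 1 + σ) (𝓝 0) (𝓝 (1 + 0)) :=
        Continuous.tendsto (by fun_prop) 0
      rw [add_zero] at this
      exact this.mono_left nhdsWithin_le_nhds
    · filter_upwards [self_mem_nhdsWithin] with σ hσ
      simpa using hσ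
  have h := (tendsto_sub_mul_tsum_nat_rpow.comp hshift).log one_ne_zero
  rw [Real.log_one] at h
  refine h.congr' ?_
  filter_upwards [self_mem_nhdsWithin] with σ hσ
  have hσ' : 0 < σ := hσ
  simp only [Function.comp_apply, add_sub_cancel_left]
  rw [← exp_tsum_logEulerFactor (by linarith), Real.log_mul hσ'.ne' (Real.exp_pos _).ne',
    Real.log_exp, add_comm]

theorem summable_mertensWeight_mul_rpow {σ : ℝ} (hσ : 0 < σ) :
    Summable fun n : ℕ => mertensWeight n * (n : ℝ) ^ (-σ) := by
  have h1 : ∀ n : ℕ, (n : ℝ) ^ (-σ) ≤ 1 := by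
    rintro (_ | n)
    · rw [Nat.cast_zero, Real.zero_rpow (by linarith)]; norm_num
    · exact Real.rpow_le_one_of_one_le_of_nonpos (by push_cast; linarith [n.cast_nonneg (α := ℝ)])
        (by linarith)
  refine Summable.of_nonneg_of_le (fun n => mul_nonneg (mertensWeight_nonneg n) (by positivity))
    (fun n => ?_) ((summable_nat_rpow_neg (by linarith : 1 < 1 + σ)).add
      (summable_one_div_nat_sq.mul_left 2))
  rw [mertensWeight_eq_logEulerFactor]
  by_cases h : n.Prime
  · have hn : (0 : ℝ) < n := by exact_mod_cast h.pos
    calc logEulerFactor 1 n * (n : ℝ) ^ (-σ)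
        ≤ ((n : ℝ) ^ (-1 : ℝ) + 2 * (1 / (n : ℝ) ^ 2)) * (n : ℝ) ^ (-σ) := by
          gcongr; exact logEulerFactor_le le_rfl n
      _ = (n : ℝ) ^ (-(1 + σ)) + 2 * (1 / (n : ℝ) ^ 2) * (n : ℝ) ^ (-σ) := by
          rw [add_mul, ← Real.rpow_add hn]; ring_nf
      _ ≤ (n : ℝ) ^ (-(1 + σ)) + 2 * (1 / (n : ℝ) ^ 2) * 1 := by gcongr; exact h1 n
      _ = _ := by rw [mul_one]
  · rw [logEulerFactor, if_neg h, zero_mul]; positivity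

/-- Replacing -log(1 - p^(-1-σ)) by w(p) p^(-σ) changes each term by at most 2/p² uniformly in σ >
0, and by a quantity tending to 0 for fixed p; dominated convergence applies. -/
theorem tendsto_tsum_mertensWeight_mul_rpow_add_log :
    Tendsto (fun σ : ℝ => ∑' n : ℕ, mertensWeight n * (n : ℝ) ^ (-σ) + Real.log σ)
      (𝓝[>] 0) (𝓝 0) := by
  have hdom : Tendsto (fun σ : ℝ => ∑' n : ℕ, (logEulerFactor (1 + σ) n -
      mertensWeight n * (n : ℝ) ^ (-σ))) (𝓝[>] 0) (𝓝 (∑' _ : ℕ, (0 : ℝ))) := by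
    refine tendsto_tsum_of_dominated_convergence (summable_one_div_nat_sq.mul_left 2) ?_ ?_
    · intro n
      by_cases hn : n.Prime
      · have hn0 : (n : ℝ) ≠ 0 := by exact_mod_cast hn.ne_zero
        have hc : ContinuousAt (fun σ : ℝ => logEulerFactor (1 + σ) n -
            mertensWeight n * (n : ℝ) ^ (-σ)) 0 := by
          simp only [logEulerFactor, if_pos hn]
          have h2 := one_div_prime_le_half hn
          have h3 : 1 - (n : ℝ) ^ (-(1 + (0 : ℝ))) ≠ 0 := by
            rw [add_zero, Real.rpow_neg_one, ← one_div]; linarith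
          have hr : ContinuousAt (fun σ : ℝ => (n : ℝ) ^ (-(1 + σ))) 0 :=
            ContinuousAt.rpow continuousAt_const (by fun_prop) (Or.inl hn0)
          have hr' : ContinuousAt (fun σ : ℝ => (n : ℝ) ^ (-σ)) 0 :=
            ContinuousAt.rpow continuousAt_const (by fun_prop) (Or.inl hn0)
          exact ((continuousAt_const.sub hr).log h3).neg.sub (continuousAt_const.mul hr')
        have := hc.tendsto
        simp only [neg_zero, Real.rpow_zero, mul_one, add_zero, mertensWeight_eq_logEulerFactor,
          sub_self] at this
        rw [mertensWeight_eq_logEulerFactor]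
        exact this.mono_left nhdsWithin_le_nhds
      · simp only [mertensWeight, logEulerFactor, if_neg hn, zero_mul, sub_zero]
        exact tendsto_const_nhds
    · filter_upwards [self_mem_nhdsWithin] with σ hσ n
      have hσ' : 0 < σ := hσ
      rw [mertensWeight_eq_logEulerFactor]
      by_cases hn : n.Prime
      · have hn0 : (0 : ℝ) < n := by exact_mod_cast hn.pos
        have h1 := logEulerFactor_bounds hn (by linarith : 1 ≤ 1 + σ)
        have h2 := logEulerFactor_bounds hn le_rfl
        have h3 : (n : ℝ) ^ (-σ) ≤ 1 :=
          Real.rpow_le_one_of_one_le_of_nonpos (by exact_mod_cast hn.one_le) (by linarith)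
        have h4 : (n : ℝ) ^ (-(1 + σ)) = (n : ℝ) ^ (-1 : ℝ) * (n : ℝ) ^ (-σ) := by
          rw [← Real.rpow_add hn0]; ring_nf
        have h5 : 0 ≤ (n : ℝ) ^ (-σ) := by positivity
        have h6 : (0 : ℝ) ≤ 1 / (n : ℝ) ^ 2 := by positivity
        rw [Real.norm_eq_abs, abs_le]
        constructor
        · nlinarith [mul_le_mul_of_nonneg_right h2.2 h5, mul_le_mul_of_nonneg_left h3 h6]
        · nlinarith [mul_le_mul_of_nonneg_right h2.1 h5]
      · simp only [logEulerFactor, if_neg hn, zero_mul, sub_zero, norm_zero]; positivity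
  rw [tsum_zero] at hdom
  have h := tendsto_tsum_logEulerFactor_add_log.sub hdom
  rw [sub_zero] at h
  refine h.congr' ?_
  filter_upwards [self_mem_nhdsWithin] with σ hσ
  have hσ' : 0 < σ := hσ
  rw [(summable_logEulerFactor (by linarith)).tsum_sub (summable_mertensWeight_mul_rpow hσ')]
  ring

/-! ### From Dirichlet series to power series in e^(-σ); the constant γ -/

theorem rpow_neg_eq_exp_neg_mul_log {n : ℕ} (hn : 0 < n) (σ : ℝ) :
    (n : ℝ) ^ (-σ) = Real.exp (-σ * Real.log n) := by
  rw [Real.rpow_def_of_pos (by exact_mod_cast hn), mul_comm]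

/-- Rounding log n up to an integer turns the Dirichlet series into a power series in e^(-σ), at the
cost of a factor between e^(-σ) and 1. -/
theorem mertensWeight_mul_exp_ceil_bounds {σ : ℝ} (hσ : 0 < σ) (n : ℕ) :
    mertensWeight n * Real.exp (-σ) ^ ⌈Real.log n⌉₊ ≤ mertensWeight n * (n : ℝ) ^ (-σ) ∧
    Real.exp (-σ) * (mertensWeight n * (n : ℝ) ^ (-σ)) ≤
      mertensWeight n * Real.exp (-σ) ^ ⌈Real.log n⌉₊ := by
  by_cases hn : n.Prime
  · have hw := mertensWeight_nonneg n
    rw [rpow_neg_eq_exp_neg_mul_log hn.pos, ← Real.exp_nat_mul]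
    have h1 := Nat.le_ceil (Real.log n)
    have h2 := (Nat.ceil_lt_add_one (Real.log_natCast_nonneg n)).le
    constructor
    · gcongr ?_ * ?_
      exact Real.exp_le_exp.2 (by nlinarith)
    · rw [mul_left_comm, ← Real.exp_add]
      gcongr ?_ * ?_
      exact Real.exp_le_exp.2 (by nlinarith)
  · simp [mertensWeight, hn]

theorem summable_mertensWeight_mul_exp_ceil {σ : ℝ} (hσ : 0 < σ) :
    Summable fun n : ℕ => mertensWeight n * Real.exp (-σ) ^ ⌈Real.log n⌉₊ :=
  Summable.of_nonneg_of_le (fun n => mul_nonneg (mertensWeight_nonneg n) (by positivity))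
    (fun n => (mertensWeight_mul_exp_ceil_bounds hσ n).1) (summable_mertensWeight_mul_rpow hσ)

/-- The rounding loss is at most (1 - e^(-σ)) W ≤ σ W, where W = -log σ + o(1) is the unrounded sum,
and σ log σ → 0. -/
theorem tendsto_tsum_mertensWeight_mul_exp_ceil_add_log :
    Tendsto (fun σ : ℝ => ∑' n : ℕ, mertensWeight n * Real.exp (-σ) ^ ⌈Real.log n⌉₊ + Real.log σ)
      (𝓝[>] 0) (𝓝 0) := by
  have hW := tendsto_tsum_mertensWeight_mul_rpow_add_log
  have hid : Tendsto (fun σ : ℝ => σ) (𝓝[>] 0) (𝓝 0) := tendsto_id.mono_left nhdsWithin_le_nhds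
  have hσlog : Tendsto (fun σ : ℝ => Real.log σ * σ) (𝓝[>] 0) (𝓝 0) := by
    simpa using tendsto_log_mul_rpow_nhdsGT_zero one_pos
  have hσW : Tendsto (fun σ : ℝ => σ * ∑' n : ℕ, mertensWeight n * (n : ℝ) ^ (-σ))
      (𝓝[>] 0) (𝓝 0) := by
    have := (hid.mul hW).sub hσlog
    simp only [mul_zero, sub_zero] at this
    refine this.congr fun σ => ?_
    ring
  have hlow := hW.sub hσW
  rw [sub_zero] at hlow
  refine tendsto_of_tendsto_of_tendsto_of_le_of_le' hlow hW ?_ ?_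
  · filter_upwards [self_mem_nhdsWithin] with σ hσ
    have hσ' : 0 < σ := hσ
    have h1 := (summable_mertensWeight_mul_rpow hσ').mul_left (Real.exp (-σ)) |>.tsum_le_tsum
      (fun n => (mertensWeight_mul_exp_ceil_bounds hσ' n).2)
      (summable_mertensWeight_mul_exp_ceil hσ')
    rw [tsum_mul_left] at h1
    have h0 : 0 ≤ ∑' n : ℕ, mertensWeight n * (n : ℝ) ^ (-σ) :=
      tsum_nonneg fun n => mul_nonneg (mertensWeight_nonneg n) (by positivity)
    have h2 := Real.add_one_le_exp (-σ)
    nlinarith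
  · filter_upwards [self_mem_nhdsWithin] with σ hσ
    have hσ' : 0 < σ := hσ
    have := (summable_mertensWeight_mul_exp_ceil hσ').tsum_le_tsum
      (fun n => (mertensWeight_mul_exp_ceil_bounds hσ' n).1) (summable_mertensWeight_mul_rpow hσ')
    linarith

theorem tendsto_neg_log_one_sub_exp_add_log :
    Tendsto (fun σ : ℝ => -Real.log (1 - Real.exp (-σ)) + Real.log σ) (𝓝[>] 0) (𝓝 0) := by
  have h : Tendsto (fun σ : ℝ => (1 - Real.exp (-σ)) / σ) (𝓝[>] 0) (𝓝 1) := by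
    have hd : HasDerivAt (fun σ : ℝ => 1 - Real.exp (-σ)) 1 0 := by
      have := ((hasDerivAt_neg (0 : ℝ)).exp).const_sub 1
      simpa using this
    have := (hasDerivAt_iff_tendsto_slope.1 hd).mono_left
      (nhdsWithin_mono 0 fun x (hx : 0 < x) => (ne_of_gt hx : x ≠ 0))
    refine this.congr fun σ => ?_
    simp [slope_def_field]
  have h' := (h.log one_ne_zero).neg
  rw [Real.log_one, neg_zero] at h'
  refine h'.congr' ?_
  filter_upwards [self_mem_nhdsWithin] with σ hσ
  have hσ' : 0 < σ := hσ
  have : Real.exp (-σ) < 1 := Real.exp_lt_one_iff.2 (by linarith)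
  rw [Real.log_div (by linarith) hσ'.ne']
  ring

/-- The mass of `mertensWeight` on the integers `n` with `⌈log n⌉ = m`. -/
def mertensBlock (m : ℕ) : ℝ :=
  ∑' n : (fun n : ℕ => ⌈Real.log n⌉₊) ⁻¹' {m}, mertensWeight n

theorem hasSum_mertensBlock_mul_pow {σ : ℝ} (hσ : 0 < σ) :
    HasSum (fun m => mertensBlock m * Real.exp (-σ) ^ m)
      (∑' n : ℕ, mertensWeight n * Real.exp (-σ) ^ ⌈Real.log n⌉₊) := by
  have h := (summable_mertensWeight_mul_exp_ceil hσ).hasSum.tsum_fiberwise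
    (fun n : ℕ => ⌈Real.log n⌉₊)
  refine h.congr_fun fun m => ?_
  rw [mertensBlock, ← tsum_mul_right]
  refine tsum_congr fun n => ?_
  rw [show ⌈Real.log (n : ℕ)⌉₊ = m from n.2]

/-- For n ≥ 1, ⌈log n⌉ ≤ M exactly when n ≤ e^M, so the blocks up to M exhaust the primes up to e^M.
-/
theorem sum_mertensBlock (M : ℕ) :
    ∑ m ∈ Finset.range (M + 1), mertensBlock m =
      ∑ p ∈ (⌊Real.exp M⌋₊).primesLE, mertensWeight p := by
  have hmem : ∀ n : ℕ, n.Prime → (n ∈ (⌊Real.exp M⌋₊).primesLE ↔ ⌈Real.log n⌉₊ ≤ M) := by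
    intro n hn
    rw [Nat.mem_primesLE, Nat.ceil_le, Real.log_le_iff_le_exp (by exact_mod_cast hn.pos),
      Nat.le_floor_iff (Real.exp_pos _).le]
    exact and_iff_left hn
  have h1 : HasSum (fun n : ℕ => if ⌈Real.log n⌉₊ ≤ M then mertensWeight n else 0)
      (∑ p ∈ (⌊Real.exp M⌋₊).primesLE, mertensWeight p) := by
    have : ∑ p ∈ (⌊Real.exp M⌋₊).primesLE, mertensWeight p =
        ∑ p ∈ (⌊Real.exp M⌋₊).primesLE, if ⌈Real.log p⌉₊ ≤ M then mertensWeight p else 0 :=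
      Finset.sum_congr rfl fun p hp =>
        (if_pos ((hmem p (Nat.prime_of_mem_primesLE hp)).1 hp)).symm
    rw [this]
    refine hasSum_sum_of_ne_finset_zero fun n hn => ?_
    by_cases hp : n.Prime
    · rw [if_neg fun h => hn ((hmem n hp).2 h)]
    · simp [mertensWeight, hp]
  have h2 := h1.tsum_fiberwise (fun n : ℕ => ⌈Real.log n⌉₊)
  have h3 : ∀ m, (∑' n : (fun n : ℕ => ⌈Real.log n⌉₊) ⁻¹' {m},
      if ⌈Real.log (n : ℕ)⌉₊ ≤ M then mertensWeight n else 0) =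
      if m ∈ Finset.range (M + 1) then mertensBlock m else 0 := by
    intro m
    have e : ∀ n : (fun n : ℕ => ⌈Real.log n⌉₊) ⁻¹' {m},
        (if ⌈Real.log (n : ℕ)⌉₊ ≤ M then mertensWeight n else 0) =
        if m ≤ M then mertensWeight n else 0 := fun n => by
      rw [show ⌈Real.log (n : ℕ)⌉₊ = m from n.2]
    rw [tsum_congr e]
    by_cases hm : m ≤ M
    · simp [hm, mertensBlock]
    · simp [hm]
  simp only [h3] at h2
  have h4 : HasSum (fun m => if m ∈ Finset.range (M + 1) then mertensBlock m else 0)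
      (∑ m ∈ Finset.range (M + 1), mertensBlock m) := by
    have := hasSum_sum_of_ne_finset_zero (L := .unconditional ℕ)
      (f := fun m => if m ∈ Finset.range (M + 1) then mertensBlock m else 0)
      (s := Finset.range (M + 1)) fun m hm => if_neg hm
    rwa [Finset.sum_congr rfl fun m hm => if_pos hm] at this
  exact h4.unique h2

theorem hasSum_one_div_mul_pow {σ : ℝ} (hσ : 0 < σ) :
    HasSum (fun m : ℕ => 1 / (m : ℝ) * Real.exp (-σ) ^ m) (-Real.log (1 - Real.exp (-σ))) := by
  have h := Real.hasSum_pow_div_log_of_abs_lt_one (x := Real.exp (-σ))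
    (by rw [abs_of_pos (Real.exp_pos _)]; exact Real.exp_lt_one_iff.2 (by linarith))
  -- The m = 0 term vanishes because 1/0 = 0.
  rw [← hasSum_nat_add_iff' 1]
  simp only [Finset.range_one, Finset.sum_singleton, Nat.cast_zero, div_zero, zero_mul, sub_zero]
  refine h.congr_fun fun m => ?_
  push_cast
  ring

/-- Mertens' third theorem in logarithmic form. -/
theorem tendsto_sum_mertensWeight_sub_log_log :
    Tendsto (fun x : ℝ => ∑ p ∈ (⌊x⌋₊).primesLE, mertensWeight p - Real.log (Real.log x))
      atTop (𝓝 Real.eulerMascheroniConstant) := by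
  obtain ⟨C, hC⟩ := exists_tendsto_sum_mertensWeight_sub_log_log
  have hreal : Tendsto (fun x : ℝ => ∑ p ∈ (⌊x⌋₊).primesLE, mertensWeight p -
      Real.log (Real.log x)) atTop (𝓝 C) := by
    have := (hC.comp tendsto_nat_floor_atTop).add tendsto_log_log_floor_sub
    rw [add_zero] at this
    refine this.congr fun x => ?_
    simp only [Function.comp_apply]
    ring
  suffices h : C = Real.eulerMascheroniConstant by rwa [h] at hreal
  -- Along x = e^M, log log x = log M, so the partial sums are (C + log M) - (γ + log M) + o(1).
  have hpart : Tendsto (fun n : ℕ => ∑ m ∈ Finset.range n, (mertensBlock m - 1 / (m : ℝ))) atTop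
      (𝓝 (C - Real.eulerMascheroniConstant)) := by
    rw [← tendsto_add_atTop_iff_nat 1]
    have h1 := hreal.comp (Real.tendsto_exp_atTop.comp (tendsto_natCast_atTop_atTop (R := ℝ)))
    have h2 := h1.sub Real.tendsto_harmonic_sub_log
    refine h2.congr fun M => ?_
    simp only [Function.comp_apply, Real.log_exp]
    rw [Finset.sum_sub_distrib, sum_mertensBlock, Finset.sum_range_succ']
    simp only [harmonic, Nat.cast_zero, div_zero, add_zero, one_div]
    push_cast
    ring
  -- Abel's theorem: the power series tends to C - γ as e^(-σ) → 1 from below. The Euler product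
  -- shows that the same limit is 0, since both series are -log σ + o(1).
  have habel := Real.tendsto_tsum_powerSeries_nhdsWithin_lt hpart
  have hexp : Tendsto (fun σ : ℝ => Real.exp (-σ)) (𝓝[>] 0) (𝓝[<] 1) := by
    refine tendsto_nhdsWithin_iff.2 ⟨?_, ?_⟩
    · have : Tendsto (fun σ : ℝ => Real.exp (-σ)) (𝓝 0) (𝓝 (Real.exp (-0))) :=
        Continuous.tendsto (by fun_prop) 0
      rw [neg_zero, Real.exp_zero] at this
      exact this.mono_left nhdsWithin_le_nhds
    · filter_upwards [self_mem_nhdsWithin] with σ hσ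
      exact Real.exp_lt_one_iff.2 (by simpa using hσ)
  have h1 := habel.comp hexp
  have h2 := tendsto_tsum_mertensWeight_mul_exp_ceil_add_log.sub tendsto_neg_log_one_sub_exp_add_log
  rw [sub_zero] at h2
  have h3 : Tendsto (fun σ : ℝ => ∑' n, (mertensBlock n - 1 / (n : ℝ)) * Real.exp (-σ) ^ n)
      (𝓝[>] 0) (𝓝 0) := by
    refine h2.congr' ?_
    filter_upwards [self_mem_nhdsWithin] with σ hσ
    have hσ' : 0 < σ := hσ
    have := (hasSum_mertensBlock_mul_pow hσ').sub (hasSum_one_div_mul_pow hσ')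
    simp only [← sub_mul] at this
    rw [this.tsum_eq]
    ring
  exact sub_eq_zero.1 (tendsto_nhds_unique h1 h3)

/-! ### Local coefficients -/

/-- The value `k (k+1) ⋯ (k+m-1) / m!` of `d_k` at the `m`-th power of a prime. -/
def divCoeff (k : ℝ) (m : ℕ) : ℝ := (ascPochhammer ℝ m).eval k / (m.factorial : ℝ)

theorem divCoeff_zero (k : ℝ) : divCoeff k 0 = 1 := by simp [divCoeff]

theorem divCoeff_one (k : ℝ) : divCoeff k 1 = k := by simp [divCoeff]

theorem divCoeff_succ (k : ℝ) (m : ℕ) :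
    divCoeff k (m + 1) = divCoeff k m * ((k + m) / (m + 1)) := by
  rw [divCoeff, divCoeff, ascPochhammer_succ_eval, Nat.factorial_succ]
  have h1 : (m.factorial : ℝ) ≠ 0 := by positivity
  have h2 : (m : ℝ) + 1 ≠ 0 := by positivity
  push_cast
  field_simp

theorem divCoeff_nonneg {k : ℝ} (hk : 0 ≤ k) (m : ℕ) : 0 ≤ divCoeff k m := by
  induction m with
  | zero => rw [divCoeff_zero]; exact zero_le_one
  | succ m ih => rw [divCoeff_succ]; positivity

/-- Compare the ratios of consecutive terms: (k² + m)(m + 1) - (k + m)² = m(k - 1)² ≥ 0. This bounds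
the local series by (1 - 1/p)^(-k²). -/
theorem divCoeff_sq_le {k : ℝ} (m : ℕ) : divCoeff k m ^ 2 ≤ divCoeff (k ^ 2) m := by
  induction m with
  | zero => simp [divCoeff_zero]
  | succ m ih =>
    rw [divCoeff_succ, divCoeff_succ, mul_pow]
    refine mul_le_mul ih ?_ (sq_nonneg _) (divCoeff_nonneg (sq_nonneg k) m)
    have hm : (0 : ℝ) ≤ m := m.cast_nonneg
    rw [div_pow, div_le_div_iff₀ (by positivity) (by positivity)]
    have : (k + m) ^ 2 ≤ (k ^ 2 + m) * (m + 1) := by nlinarith [mul_nonneg hm (sq_nonneg (k - 1))]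
    nlinarith

/-- Coefficient form of F' = k F/(1 - z) for F = (1 - z)^(-k). It is the recursion of `expCoeff`
without the truncation. -/
theorem mul_sum_divCoeff (k : ℝ) (m : ℕ) :
    k * ∑ i ∈ Finset.range (m + 1), divCoeff k i = (m + 1) * divCoeff k (m + 1) := by
  induction m with
  | zero => simp [divCoeff_zero, divCoeff_one]
  | succ m ih =>
    rw [Finset.sum_range_succ, mul_add, ih, divCoeff_succ k (m + 1)]
    push_cast
    have : (m : ℝ) + 1 + 1 ≠ 0 := by positivity
    field_simp
    ring

theorem hasSum_divCoeff (a : ℝ) {x : ℝ} (hx : |x| < 1) :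
    HasSum (fun m => divCoeff a m * x ^ m) (1 / (1 - x) ^ a) := by
  have h := (Real.one_div_one_sub_rpow_hasFPowerSeriesOnBall_zero a).hasSum (y := x) (by
    rw [Metric.mem_eball, edist_zero_right, ← ofReal_norm, Real.norm_eq_abs]
    simpa using hx)
  simp only [zero_add, FormalMultilinearSeries.ofScalars_apply_eq, smul_eq_mul] at h
  refine h.congr_fun fun m => ?_
  congr 1
  rw [← Ring.multichoose_eq, divCoeff, div_eq_iff (by positivity),
    ← Polynomial.ascPochhammer_smeval_eq_eval,
    ← Ring.factorial_nsmul_multichoose_eq_ascPochhammer]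
  simp [mul_comm]

/-- The Taylor coefficients of `exp (k (z + z²/2 + ⋯ + z^M/M))`. -/
def expCoeff (k : ℝ) (M : ℕ) : ℕ → ℝ
  | 0 => 1
  | m + 1 => k / (m + 1) * ∑ i : Fin (m + 1), if m - i < M then expCoeff k M i else 0

theorem expCoeff_zero (k : ℝ) (M : ℕ) : expCoeff k M 0 = 1 := by rw [expCoeff]

theorem expCoeff_succ (k : ℝ) (M m : ℕ) :
    expCoeff k M (m + 1) =
      k / (m + 1) * ∑ i ∈ Finset.range (m + 1), if m - i < M then expCoeff k M i else 0 := by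
  rw [expCoeff, Finset.sum_range]

theorem expCoeff_nonneg {k : ℝ} (hk : 0 ≤ k) (M m : ℕ) : 0 ≤ expCoeff k M m := by
  induction m using Nat.strong_induction_on with
  | _ m ih =>
    rcases m with _ | m
    · rw [expCoeff_zero]; exact zero_le_one
    · rw [expCoeff_succ]
      refine mul_nonneg (by positivity) (Finset.sum_nonneg fun i hi => ?_)
      split_ifs
      · exact ih i (Finset.mem_range.1 hi)
      · rfl

/-- Both sequences obey the same recursion with nonnegative terms, except that the truncated one
drops some of them; none is dropped up to index M. -/
theorem expCoeff_le_divCoeff {k : ℝ} (hk : 0 ≤ k) (M m : ℕ) : expCoeff k M m ≤ divCoeff k m := by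
  induction m using Nat.strong_induction_on with
  | _ m ih =>
    rcases m with _ | m
    · rw [expCoeff_zero, divCoeff_zero]
    · have h : divCoeff k (m + 1) = k / (m + 1) * ∑ i ∈ Finset.range (m + 1), divCoeff k i := by
        rw [div_mul_eq_mul_div, mul_sum_divCoeff]; field_simp
      rw [expCoeff_succ, h]
      refine mul_le_mul_of_nonneg_left (Finset.sum_le_sum fun i hi => ?_) (by positivity)
      split_ifs
      · exact ih i (Finset.mem_range.1 hi)
      · exact divCoeff_nonneg hk i

theorem expCoeff_eq_divCoeff (k : ℝ) {M m : ℕ} (hm : m ≤ M) : expCoeff k M m = divCoeff k m := by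
  induction m using Nat.strong_induction_on with
  | _ m ih =>
    rcases m with _ | m
    · rw [expCoeff_zero, divCoeff_zero]
    · have h : divCoeff k (m + 1) = k / (m + 1) * ∑ i ∈ Finset.range (m + 1), divCoeff k i := by
        rw [div_mul_eq_mul_div, mul_sum_divCoeff]; field_simp
      rw [expCoeff_succ, h]
      congr 1
      refine Finset.sum_congr rfl fun i hi => ?_
      have := Finset.mem_range.1 hi
      rw [if_pos (by omega), ih i this (by omega)]

/-- With f the exponential, f' = f g where g = k(1 + z + ⋯ + z^(M-1)); Leibniz' rule at 0 is then
the recursion defining `expCoeff`. -/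
theorem iteratedDeriv_exp_truncLog (k : ℝ) (M m : ℕ) :
    iteratedDeriv m (fun z : ℂ => Complex.exp (k * ∑ j ∈ Finset.range M, z ^ (j + 1) / (j + 1))) 0 =
      (m.factorial : ℂ) * (expCoeff k M m : ℂ) := by
  set f : ℂ → ℂ := fun z => Complex.exp (k * ∑ j ∈ Finset.range M, z ^ (j + 1) / (j + 1)) with hf
  set g : ℂ → ℂ := fun z => k * ∑ j ∈ Finset.range M, z ^ j with hg
  have hgc : ContDiff ℂ ⊤ g := by fun_prop
  have hfc : ContDiff ℂ ⊤ f := by fun_prop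
  have hderiv : deriv f = f * g := by
    funext z
    have h1 : HasDerivAt (fun z : ℂ => (k : ℂ) * ∑ j ∈ Finset.range M, z ^ (j + 1) / (j + 1))
        (g z) z := by
      refine HasDerivAt.const_mul _ (HasDerivAt.fun_sum fun j _ => ?_)
      have h2 := (hasDerivAt_pow (j + 1) z).div_const ((j : ℂ) + 1)
      have h3 : (j : ℂ) + 1 ≠ 0 := by exact_mod_cast Nat.succ_ne_zero j
      have h4 : ((j + 1 : ℕ) : ℂ) * z ^ (j + 1 - 1) / (j + 1) = z ^ j := by
        rw [Nat.add_sub_cancel, div_eq_iff h3]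
        push_cast
        ring
      rw [h4] at h2
      exact h2
    exact h1.cexp.deriv
  have hgd : ∀ i, iteratedDeriv i g 0 = if i < M then (k : ℂ) * i.factorial else 0 := by
    intro i
    rw [hg, iteratedDeriv_const_mul_field, iteratedDeriv_fun_sum (fun j _ => by fun_prop)]
    simp only [iteratedDeriv_fun_pow_zero]
    by_cases hi : i < M
    · simp [hi]
    · simp [hi]
  induction m using Nat.strong_induction_on with
  | _ m ih =>
    rcases m with _ | m
    · simp [hf, expCoeff_zero]
    · rw [iteratedDeriv_succ', hderiv,
        iteratedDeriv_mul (hfc.contDiffAt.of_le le_top) (hgc.contDiffAt.of_le le_top),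
        expCoeff_succ, Nat.factorial_succ]
      push_cast
      have hm : (m : ℂ) + 1 ≠ 0 := by exact_mod_cast Nat.succ_ne_zero m
      have e : ((m : ℂ) + 1) * (m.factorial : ℂ) * ((k : ℂ) / (m + 1) *
          ∑ i ∈ Finset.range (m + 1), ((if m - i < M then expCoeff k M i else 0 : ℝ) : ℂ)) =
          ∑ i ∈ Finset.range (m + 1), (m.factorial : ℂ) * k *
            ((if m - i < M then expCoeff k M i else 0 : ℝ) : ℂ) := by
        rw [← Finset.mul_sum]; field_simp
      rw [e]
      refine Finset.sum_congr rfl fun i hi => ?_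
      have hi' := Finset.mem_range.1 hi
      rw [ih i hi', hgd]
      have hch : ((m.choose i : ℕ) : ℂ) * i.factorial * (m - i).factorial = m.factorial := by
        exact_mod_cast Nat.choose_mul_factorial_mul_factorial (by omega : i ≤ m)
      split_ifs
      · rw [← hch]; ring
      · simp

theorem hasSum_expCoeff (k : ℝ) (M : ℕ) (z : ℂ) :
    HasSum (fun m => (expCoeff k M m : ℂ) * z ^ m)
      (Complex.exp (k * ∑ j ∈ Finset.range M, z ^ (j + 1) / (j + 1))) := by
  have h := Complex.hasSum_taylorSeries_of_entire (f := fun z : ℂ =>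
    Complex.exp (k * ∑ j ∈ Finset.range M, z ^ (j + 1) / (j + 1))) (by fun_prop) 0 z
  refine h.congr_fun fun m => ?_
  rw [iteratedDeriv_exp_truncLog]
  have : (m.factorial : ℂ) ≠ 0 := by exact_mod_cast m.factorial_ne_zero
  simp only [sub_zero, smul_eq_mul]
  field_simp

/-! ### Local factors -/

theorem localSum_eq (k : ℝ) {p : ℕ} (hp : p.Prime) :
    localSum k p = ∑' m : ℕ, divCoeff k m ^ 2 / (p : ℝ) ^ m := by
  simp only [localSum, divisorFn_prime_pow k hp, divCoeff]

theorem hasSum_divCoeff_prime (a : ℝ) {p : ℕ} (hp : p.Prime) :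
    HasSum (fun m : ℕ => divCoeff a m / (p : ℝ) ^ m) (1 / (1 - 1 / (p : ℝ)) ^ a) := by
  have h2 := one_div_prime_le_half hp
  have h := hasSum_divCoeff a (x := 1 / (p : ℝ)) (by
    rw [abs_of_nonneg (by positivity)]; linarith)
  refine h.congr_fun fun m => ?_
  rw [one_div, inv_pow, div_eq_mul_inv]

theorem summable_divCoeff_sq (k : ℝ) {p : ℕ} (hp : p.Prime) :
    Summable fun m : ℕ => divCoeff k m ^ 2 / (p : ℝ) ^ m :=
  Summable.of_nonneg_of_le (fun m => by positivity)
    (fun m => div_le_div_of_nonneg_right (divCoeff_sq_le m) (by positivity))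
    (hasSum_divCoeff_prime (k ^ 2) hp).summable

theorem localSum_le (k : ℝ) {p : ℕ} (hp : p.Prime) :
    localSum k p ≤ 1 / (1 - 1 / (p : ℝ)) ^ (k ^ 2) := by
  rw [localSum_eq k hp, ← (hasSum_divCoeff_prime (k ^ 2) hp).tsum_eq]
  exact (summable_divCoeff_sq k hp).tsum_le_tsum
    (fun m => div_le_div_of_nonneg_right (divCoeff_sq_le m) (by positivity))
    (hasSum_divCoeff_prime (k ^ 2) hp).summable

theorem localSum_eq_add (k : ℝ) {p : ℕ} (hp : p.Prime) :
    localSum k p = 1 + k ^ 2 / p + ∑' m : ℕ, divCoeff k (m + 2) ^ 2 / (p : ℝ) ^ (m + 2) := by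
  rw [localSum_eq k hp, ← (summable_divCoeff_sq k hp).sum_add_tsum_nat_add 2]
  simp [Finset.sum_range_succ, divCoeff_zero, divCoeff_one]

theorem one_add_le_localSum (k : ℝ) {p : ℕ} (hp : p.Prime) :
    1 + k ^ 2 / p ≤ localSum k p := by
  rw [localSum_eq_add k hp]
  have : 0 ≤ ∑' m : ℕ, divCoeff k (m + 2) ^ 2 / (p : ℝ) ^ (m + 2) :=
    tsum_nonneg fun m => by positivity
  linarith

theorem one_le_localSum (k : ℝ) {p : ℕ} (hp : p.Prime) : 1 ≤ localSum k p := by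
  have := one_add_le_localSum k hp
  have : 0 ≤ k ^ 2 / (p : ℝ) := by positivity
  linarith

theorem exists_tsum_divCoeff_add_two_le (k : ℝ) :
    ∃ C : ℝ, ∀ p : ℕ, p.Prime →
      ∑' m : ℕ, divCoeff k (m + 2) ^ 2 / (p : ℝ) ^ (m + 2) ≤ C * (1 / (p : ℝ) ^ 2) := by
  have h2 := (summable_nat_add_iff 2).2 (summable_divCoeff_sq k Nat.prime_two)
  -- Since p^(m+2) ≥ 2^m p², the tail at the prime 2 dominates all of them; the 4 restores 2^(m+2).
  refine ⟨4 * ∑' m : ℕ, divCoeff k (m + 2) ^ 2 / ((2 : ℕ) : ℝ) ^ (m + 2), fun p hp => ?_⟩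
  rw [← tsum_mul_left, ← tsum_mul_right]
  refine ((summable_nat_add_iff 2).2 (summable_divCoeff_sq k hp)).tsum_le_tsum (fun m => ?_)
    ((h2.mul_left 4).mul_right _)
  have h : ((2 : ℕ) : ℝ) ^ m ≤ (p : ℝ) ^ m := by
    gcongr; exact hp.two_le
  have hp0 : (0 : ℝ) < p := by exact_mod_cast hp.pos
  have e : 4 * (divCoeff k (m + 2) ^ 2 / ((2 : ℕ) : ℝ) ^ (m + 2)) * (1 / (p : ℝ) ^ 2) =
      divCoeff k (m + 2) ^ 2 / (((2 : ℕ) : ℝ) ^ m * (p : ℝ) ^ 2) := by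
    push_cast; field_simp; ring
  rw [e, pow_add]
  gcongr

/-! ### The arithmetic constant -/

theorem one_sub_one_div_prime_pos {p : ℕ} (hp : p.Prime) : 0 < 1 - 1 / (p : ℝ) := by
  linarith [one_div_prime_le_half hp]

theorem localSum_pos (k : ℝ) {p : ℕ} (hp : p.Prime) : 0 < localSum k p :=
  one_pos.trans_le (one_le_localSum k hp)

theorem arithFactor_pos (k : ℝ) {p : ℕ} (hp : p.Prime) :
    0 < (1 - 1 / (p : ℝ)) ^ (k ^ 2) * localSum k p :=
  mul_pos (Real.rpow_pos_of_pos (one_sub_one_div_prime_pos hp) _) (localSum_pos k hp)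

theorem log_arithFactor (k : ℝ) {p : ℕ} (hp : p.Prime) :
    Real.log ((1 - 1 / (p : ℝ)) ^ (k ^ 2) * localSum k p) =
      Real.log (localSum k p) - k ^ 2 * mertensWeight p := by
  rw [Real.log_mul (Real.rpow_pos_of_pos (one_sub_one_div_prime_pos hp) _).ne'
    (localSum_pos k hp).ne', Real.log_rpow (one_sub_one_div_prime_pos hp), mertensWeight, if_pos hp]
  ring

theorem log_localSum_le (k : ℝ) {p : ℕ} (hp : p.Prime) :
    Real.log (localSum k p) ≤ k ^ 2 * mertensWeight p := by
  have h := Real.log_le_log (localSum_pos k hp) (localSum_le k hp)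
  rw [one_div, Real.log_inv, Real.log_rpow (one_sub_one_div_prime_pos hp)] at h
  rw [mertensWeight, if_pos hp]
  linarith

theorem log_localSum_nonneg (k : ℝ) {p : ℕ} (hp : p.Prime) : 0 ≤ Real.log (localSum k p) :=
  Real.log_nonneg (one_le_localSum k hp)

theorem mertensWeight_le {p : ℕ} (hp : p.Prime) :
    mertensWeight p ≤ 1 / p + 2 * (1 / (p : ℝ) ^ 2) := by
  have h := neg_log_one_sub_le_add_sq (one_div_prime_le_half hp)
  rw [div_pow, one_pow] at h
  rwa [mertensWeight, if_pos hp]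

/-- The terms k²/p cancel. The 2k² comes from w(p) ≤ 1/p + 2/p², and the k⁴ from log(1 + u) ≥ u - u²
at u = k²/p. -/
theorem abs_log_arithFactor_le (k : ℝ) {p : ℕ} (hp : p.Prime) :
    |Real.log ((1 - 1 / (p : ℝ)) ^ (k ^ 2) * localSum k p)| ≤
      (2 * k ^ 2 + k ^ 4) * (1 / (p : ℝ) ^ 2) := by
  have hp0 : (0 : ℝ) < p := by exact_mod_cast hp.pos
  rw [log_arithFactor k hp, abs_of_nonpos (by linarith [log_localSum_le k hp])]
  have h1 := Real.log_le_log (by positivity) (one_add_le_localSum k hp)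
  have h2 := Real.one_sub_inv_le_log_of_pos (by positivity : 0 < 1 + k ^ 2 / (p : ℝ))
  have h3 : k ^ 2 / p - (k ^ 2 / p) ^ 2 ≤ 1 - (1 + k ^ 2 / (p : ℝ))⁻¹ := by
    have hu : 0 ≤ k ^ 2 / (p : ℝ) := by positivity
    set u := k ^ 2 / (p : ℝ)
    have : 1 - (1 + u)⁻¹ = u / (1 + u) := by field_simp; ring
    rw [this, le_div_iff₀ (by positivity)]
    nlinarith [pow_nonneg hu 3]
  have h4 := mul_le_mul_of_nonneg_left (mertensWeight_le hp) (sq_nonneg k)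
  have h5 : (k ^ 2 / (p : ℝ)) ^ 2 = k ^ 4 * (1 / (p : ℝ) ^ 2) := by field_simp
  have h6 : k ^ 2 * (1 / (p : ℝ) + 2 * (1 / (p : ℝ) ^ 2)) =
    k ^ 2 / p + 2 * k ^ 2 * (1 / (p : ℝ) ^ 2) := by ring
  linarith

theorem summable_log_arithFactor (k : ℝ) :
    Summable fun p : Nat.Primes =>
      Real.log ((1 - 1 / ((p : ℕ) : ℝ)) ^ (k ^ 2) * localSum k p) := by
  have hs : Summable fun p : Nat.Primes => (2 * k ^ 2 + k ^ 4) * (1 / ((p : ℕ) : ℝ) ^ 2) :=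
    (summable_one_div_nat_sq.mul_left (2 * k ^ 2 + k ^ 4)).comp_injective
      Nat.Primes.coe_nat_injective
  exact hs.of_norm_bounded fun p => by
    rw [Real.norm_eq_abs]; exact abs_log_arithFactor_le k p.2

theorem multipliable_arithFactor (k : ℝ) :
    Multipliable fun p : Nat.Primes =>
      (1 - 1 / ((p : ℕ) : ℝ)) ^ (k ^ 2) * localSum k p :=
  Real.multipliable_of_summable_log (fun p => arithFactor_pos k p.2) (summable_log_arithFactor k)

theorem exp_tsum_log_arithFactor (k : ℝ) :
    Real.exp (∑' p : Nat.Primes, Real.log ((1 - 1 / ((p : ℕ) : ℝ)) ^ (k ^ 2) * localSum k p)) =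
      arithConst k :=
  Real.rexp_tsum_eq_tprod (fun p : Nat.Primes => arithFactor_pos k p.2)
    (summable_log_arithFactor k)

theorem arithConst_pos (k : ℝ) : 0 < arithConst k := by
  rw [← exp_tsum_log_arithFactor]; exact Real.exp_pos _

/-- The logarithm of the local series is k² w(p) plus the logarithm of the factor of a_k: Mertens
handles the first, absolute convergence the second. -/
theorem tendsto_sum_log_localSum_sub (k : ℝ) :
    Tendsto (fun x : ℝ => ∑ p ∈ (⌊x⌋₊).primesLE, Real.log (localSum k p) -
      k ^ 2 * Real.log (Real.log x)) atTop
      (𝓝 (Real.log (arithConst k) + k ^ 2 * Real.eulerMascheroniConstant)) := by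
  let F : ℕ → ℝ := fun p => Real.log ((1 - 1 / (p : ℝ)) ^ (k ^ 2) * localSum k p)
  have h1 : HasSum (Set.indicator {p | Nat.Prime p} F) (Real.log (arithConst k)) := by
    have h := (summable_log_arithFactor k).hasSum
    rw [← exp_tsum_log_arithFactor, Real.log_exp]
    exact hasSum_subtype_iff_indicator.1 h
  have h2 := (h1.tendsto_sum_nat.comp (tendsto_add_atTop_nat 1)).comp
    (tendsto_nat_floor_atTop (α := ℝ))
  have h3 := h2.add (tendsto_sum_mertensWeight_sub_log_log.const_mul (k ^ 2))
  refine h3.congr fun x => ?_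
  simp only [Function.comp_apply]
  have e : ∑ i ∈ Finset.range (⌊x⌋₊ + 1), Set.indicator {p | Nat.Prime p} F i =
      ∑ p ∈ (⌊x⌋₊).primesLE, (Real.log (localSum k p) - k ^ 2 * mertensWeight p) := by
    rw [Nat.primesLE_eq_filter_range, Finset.sum_filter]
    refine Finset.sum_congr rfl fun p _ => ?_
    rw [Set.indicator_apply]
    by_cases hp : p.Prime
    · simp only [Set.mem_ofPred_eq, hp, if_true, F, log_arithFactor k hp]
    · simp only [Set.mem_ofPred_eq, hp, if_false]
  rw [e, Finset.sum_sub_distrib, ← Finset.mul_sum]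
  ring

theorem tendsto_prod_localSum_div (k : ℝ) :
    Tendsto (fun x : ℝ => (∏ p ∈ (⌊x⌋₊).primesLE, localSum k p) /
      (arithConst k * (Real.exp Real.eulerMascheroniConstant * Real.log x) ^ (k ^ 2)))
      atTop (𝓝 1) := by
  have h := (tendsto_sum_log_localSum_sub k).sub_const
    (Real.log (arithConst k) + k ^ 2 * Real.eulerMascheroniConstant)
  rw [sub_self] at h
  have h' := (Real.continuous_exp.tendsto 0).comp h
  rw [Real.exp_zero] at h'
  refine h'.congr' ?_
  filter_upwards [eventually_gt_atTop 1] with x hx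
  have hl : 0 < Real.log x := Real.log_pos hx
  simp only [Function.comp_apply]
  have ha := arithConst_pos k
  have hpos : 0 < Real.exp Real.eulerMascheroniConstant * Real.log x := by positivity
  have hP : 0 < ∏ p ∈ (⌊x⌋₊).primesLE, localSum k p :=
    Finset.prod_pos fun p hp => localSum_pos k (Nat.prime_of_mem_primesLE hp)
  rw [← Real.exp_log (div_pos hP (mul_pos ha (Real.rpow_pos_of_pos hpos _)))]
  congr 1
  rw [Real.log_div hP.ne' (mul_pos ha (Real.rpow_pos_of_pos hpos _)).ne',
    Real.log_mul ha.ne' (Real.rpow_pos_of_pos hpos _).ne', Real.log_rpow hpos,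
    Real.log_mul (Real.exp_pos _).ne' hl.ne', Real.log_exp,
    Real.log_prod fun p hp => (localSum_pos k (Nat.prime_of_mem_primesLE hp)).ne']
  ring

/-! ### Truncated local factors -/

/-- The local factor of the mean square of `P_X ^ k` at `p`, where `M` is the largest integer with
`p ^ M ≤ X`. -/
def truncLocalSum (k : ℝ) (M p : ℕ) : ℝ := ∑' m : ℕ, expCoeff k M m ^ 2 / (p : ℝ) ^ m

theorem expCoeff_sq_le {k : ℝ} (hk : 0 ≤ k) (M m : ℕ) : expCoeff k M m ^ 2 ≤ divCoeff k m ^ 2 :=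
  pow_le_pow_left₀ (expCoeff_nonneg hk M m) (expCoeff_le_divCoeff hk M m) 2

theorem summable_expCoeff_sq {k : ℝ} (hk : 0 ≤ k) (M : ℕ) {p : ℕ} (hp : p.Prime) :
    Summable fun m : ℕ => expCoeff k M m ^ 2 / (p : ℝ) ^ m :=
  Summable.of_nonneg_of_le (fun m => by positivity)
    (fun m => div_le_div_of_nonneg_right (expCoeff_sq_le hk M m) (by positivity))
    (summable_divCoeff_sq k hp)

theorem truncLocalSum_le {k : ℝ} (hk : 0 ≤ k) (M : ℕ) {p : ℕ} (hp : p.Prime) :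
    truncLocalSum k M p ≤ localSum k p := by
  rw [localSum_eq k hp]
  exact (summable_expCoeff_sq hk M hp).tsum_le_tsum
    (fun m => div_le_div_of_nonneg_right (expCoeff_sq_le hk M m) (by positivity))
    (summable_divCoeff_sq k hp)

/-- The coefficients agree up to exponent M, so the terms m < j cancel; the remaining truncated
terms are nonnegative and can be dropped. -/
theorem localSum_sub_truncLocalSum_le {k : ℝ} (hk : 0 ≤ k) {M j : ℕ} (hj : j ≤ M + 1) {p : ℕ}
    (hp : p.Prime) :
    localSum k p - truncLocalSum k M p ≤ ∑' m : ℕ, divCoeff k (m + j) ^ 2 / (p : ℝ) ^ (m + j) := by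
  have h1 : ∑ m ∈ Finset.range j, divCoeff k m ^ 2 / (p : ℝ) ^ m ≤ truncLocalSum k M p := by
    have h := (summable_expCoeff_sq hk M hp).sum_le_tsum (Finset.range j)
      (fun m _ => by positivity)
    refine le_trans (le_of_eq (Finset.sum_congr rfl fun m hm => ?_)) h
    have := Finset.mem_range.1 hm
    rw [expCoeff_eq_divCoeff k (by omega)]
  have h2 := (summable_divCoeff_sq k hp).sum_add_tsum_nat_add j
  rw [← localSum_eq k hp] at h2
  linarith

theorem one_le_truncLocalSum {k : ℝ} (hk : 0 ≤ k) (M : ℕ) {p : ℕ} (hp : p.Prime) :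
    1 ≤ truncLocalSum k M p := by
  have h := (summable_expCoeff_sq hk M hp).sum_le_tsum (Finset.range 1)
    (fun m _ => by positivity)
  rw [truncLocalSum]
  simpa [expCoeff_zero] using h

/-- Dominated convergence over p. For fixed p the truncation exponent tends to infinity, so the
difference is bounded by a vanishing tail. For every p ≤ N the exponent is at least 1, so the
difference starts at m = 2 and is O(1/p²). -/
theorem tendsto_sum_localSum_sub_truncLocalSum {k : ℝ} (hk : 0 ≤ k) :
    Tendsto (fun N : ℕ => ∑ p ∈ N.primesLE,
      (localSum k p - truncLocalSum k (Nat.log p N) p)) atTop (𝓝 0) := by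
  obtain ⟨C, hC⟩ := exists_tsum_divCoeff_add_two_le k
  let g : ℕ → ℕ → ℝ := fun N p =>
    if p ∈ N.primesLE then localSum k p - truncLocalSum k (Nat.log p N) p else 0
  have hg0 : ∀ N p, 0 ≤ g N p := by
    intro N p
    simp only [g]
    split_ifs with h
    · exact sub_nonneg.2 (truncLocalSum_le hk _ (Nat.prime_of_mem_primesLE h))
    · rfl
  have hlim : Tendsto (fun N : ℕ => ∑' p, g N p) atTop (𝓝 (∑' _ : ℕ, (0 : ℝ))) := by
    refine tendsto_tsum_of_dominated_convergence (summable_one_div_nat_sq.mul_left |C|) ?_ ?_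
    · intro p
      by_cases hp : p.Prime
      · have htail := tendsto_sum_nat_add fun m : ℕ => divCoeff k m ^ 2 / (p : ℝ) ^ m
        have hlog : Tendsto (fun N : ℕ => Nat.log p N + 1) atTop atTop := by
          refine (tendsto_add_atTop_nat 1).comp (tendsto_atTop.2 fun M => ?_)
          filter_upwards [eventually_ge_atTop (p ^ M)] with N hN
          exact Nat.le_log_of_pow_le hp.one_lt hN
        refine squeeze_zero (fun N => hg0 N p) (fun N => ?_) (htail.comp hlog)
        simp only [g, Function.comp_apply]
        split_ifs
        · exact localSum_sub_truncLocalSum_le hk le_rfl hp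
        · exact tsum_nonneg fun m => by positivity
      · refine tendsto_const_nhds.congr fun N => ?_
        simp only [g]
        rw [if_neg fun h => hp (Nat.prime_of_mem_primesLE h)]
    · refine Eventually.of_forall fun N p => ?_
      rw [Real.norm_of_nonneg (hg0 N p)]
      simp only [g]
      split_ifs with h
      · have hp := Nat.prime_of_mem_primesLE h
        have h1 : 1 ≤ Nat.log p N :=
          Nat.le_log_of_pow_le hp.one_lt (by simpa using Nat.le_of_mem_primesLE h)
        refine (localSum_sub_truncLocalSum_le hk (by omega : 2 ≤ Nat.log p N + 1) hp).trans
          ((hC p hp).trans ?_)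
        gcongr
        exact le_abs_self C
      · positivity
  rw [tsum_zero] at hlim
  refine hlim.congr fun N => ?_
  rw [tsum_eq_sum (s := N.primesLE) fun p hp => if_neg hp]
  exact Finset.sum_congr rfl fun p hp => if_pos hp

theorem one_sub_sum_le_prod {ι : Type*} (s : Finset ι) (y : ι → ℝ) (h0 : ∀ i ∈ s, 0 ≤ y i)
    (h1 : ∀ i ∈ s, y i ≤ 1) : 1 - ∑ i ∈ s, (1 - y i) ≤ ∏ i ∈ s, y i := by
  classical
  induction s using Finset.induction_on with
  | empty => simp
  | insert a s ha ih =>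
    rw [Finset.sum_insert ha, Finset.prod_insert ha]
    have ih' := ih (fun i hi => h0 i (Finset.mem_insert_of_mem hi))
      (fun i hi => h1 i (Finset.mem_insert_of_mem hi))
    have ha0 := h0 a (Finset.mem_insert_self _ _)
    have ha1 := h1 a (Finset.mem_insert_self _ _)
    have hp : ∏ i ∈ s, y i ≤ 1 :=
      Finset.prod_le_one (fun i hi => h0 i (Finset.mem_insert_of_mem hi))
        fun i hi => h1 i (Finset.mem_insert_of_mem hi)
    nlinarith

/-- The diagonal contribution to the moment, as an Euler product; here `N = ⌊X⌋`. -/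
def diagonalProd (k : ℝ) (N q : ℕ) : ℝ :=
  ∏ p ∈ N.primesLE with ¬p ∣ q, truncLocalSum k (Nat.log p N) p

theorem one_le_diagonalProd {k : ℝ} (hk : 0 ≤ k) (N q : ℕ) : 1 ≤ diagonalProd k N q :=
  Finset.prod_induction _ (fun x => 1 ≤ x) (fun _ _ => one_le_mul_of_one_le_of_one_le) le_rfl
    fun _ hp => one_le_truncLocalSum hk _ (Nat.prime_of_mem_primesLE (Finset.mem_filter.1 hp).1)

theorem primesLE_filter_dvd {X : ℝ} (hX : 0 ≤ X) {q : ℕ} (hq : q ≠ 0) :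
    (⌊X⌋₊.primesLE.filter fun p => p ∣ q) = q.primeFactors.filter fun p : ℕ => (p : ℝ) ≤ X := by
  ext p
  simp only [Finset.mem_filter, Nat.mem_primesLE, Nat.mem_primeFactors, Nat.le_floor_iff hX]
  tauto

/-- The right-hand side of the asymptotic formula restricted to the primes `p ≤ X`. -/
def mainTerm (k X : ℝ) (q : ℕ) : ℝ :=
  arithConst k * (∏ p ∈ q.primeFactors with (p : ℕ) ≤ X, (localSum k p)⁻¹) *
    (Real.exp Real.eulerMascheroniConstant * Real.log X) ^ (k ^ 2)

theorem diagonalProd_div_mainTerm (k : ℝ) {X : ℝ} (hX : 1 < X) {q : ℕ} (hq : q ≠ 0) :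
    diagonalProd k ⌊X⌋₊ q / mainTerm k X q =
      (∏ p ∈ ⌊X⌋₊.primesLE with ¬p ∣ q, truncLocalSum k (Nat.log p ⌊X⌋₊) p / localSum k p) *
      ((∏ p ∈ ⌊X⌋₊.primesLE, localSum k p) /
        (arithConst k * (Real.exp Real.eulerMascheroniConstant * Real.log X) ^ (k ^ 2))) := by
  have hne : ∀ p ∈ ⌊X⌋₊.primesLE, localSum k p ≠ 0 := fun p hp =>
    (localSum_pos k (Nat.prime_of_mem_primesLE hp)).ne'
  have hl : 0 < Real.log X := Real.log_pos hX
  have ha := arithConst_pos k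
  have hE : 0 < (Real.exp Real.eulerMascheroniConstant * Real.log X) ^ (k ^ 2) := by positivity
  have h1 : ∏ p ∈ ⌊X⌋₊.primesLE with ¬p ∣ q, localSum k p ≠ 0 :=
    Finset.prod_ne_zero_iff.2 fun p hp => hne p (Finset.mem_filter.1 hp).1
  have h2 : ∏ p ∈ ⌊X⌋₊.primesLE with p ∣ q, localSum k p ≠ 0 :=
    Finset.prod_ne_zero_iff.2 fun p hp => hne p (Finset.mem_filter.1 hp).1
  rw [mainTerm, ← primesLE_filter_dvd (by linarith) hq, Finset.prod_inv_distrib,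
    Finset.prod_div_distrib, diagonalProd,
    ← Finset.prod_filter_mul_prod_filter_not ⌊X⌋₊.primesLE (fun p => p ∣ q) (localSum k)]
  field_simp

/-- Each ratio of truncated to full factor lies in [0, 1], so one minus their product is at most the
sum of the deficits. A deficit is at most the difference of the factors, because the full one is at
least 1; dropping the primes dividing q only helps, which gives uniformity in q. -/
theorem isEquivalent_diagonalProd_mainTerm {k : ℝ} (hk : 0 ≤ k) {ι : Type*} {l : Filter ι}
    {X : ι → ℝ} {q : ι → ℕ} (hX : Tendsto X l atTop) (hq : ∀ᶠ i in l, q i ≠ 0) :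
    (fun i => diagonalProd k ⌊X i⌋₊ (q i)) ~[l] fun i => mainTerm k (X i) (q i) := by
  refine isEquivalent_of_tendsto_one ?_
  have h1 : Tendsto (fun i => ∏ p ∈ ⌊X i⌋₊.primesLE with ¬p ∣ q i,
      truncLocalSum k (Nat.log p ⌊X i⌋₊) p / localSum k p) l (𝓝 1) := by
    have hlow := ((tendsto_sum_localSum_sub_truncLocalSum hk).comp
      ((tendsto_nat_floor_atTop (α := ℝ)).comp hX)).const_sub 1
    rw [sub_zero] at hlow
    have hb : ∀ N p, p ∈ N.primesLE → 0 ≤ truncLocalSum k (Nat.log p N) p / localSum k p ∧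
        truncLocalSum k (Nat.log p N) p / localSum k p ≤ 1 := by
      intro N p hp
      have hp' := Nat.prime_of_mem_primesLE hp
      have h1 := one_le_truncLocalSum hk (Nat.log p N) hp'
      have h2 := localSum_pos k hp'
      exact ⟨by positivity, (div_le_one h2).2 (truncLocalSum_le hk _ hp')⟩
    refine tendsto_of_tendsto_of_tendsto_of_le_of_le hlow tendsto_const_nhds (fun i => ?_)
      fun i => ?_
    · refine le_trans ?_ (one_sub_sum_le_prod _ _
        (fun p hp => (hb _ p (Finset.mem_filter.1 hp).1).1)
        fun p hp => (hb _ p (Finset.mem_filter.1 hp).1).2)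
      simp only [Function.comp_apply]
      refine sub_le_sub_left ?_ 1
      refine (Finset.sum_le_sum_of_subset_of_nonneg (Finset.filter_subset _ _)
        fun p hp _ => sub_nonneg.2 (hb _ p hp).2).trans (Finset.sum_le_sum fun p hp => ?_)
      have hp' := Nat.prime_of_mem_primesLE hp
      have h2 := one_le_localSum k hp'
      have h3 := truncLocalSum_le hk (Nat.log p ⌊X i⌋₊) hp'
      rw [one_sub_div (by linarith), div_le_iff₀ (by linarith)]
      nlinarith
    · exact Finset.prod_le_one (fun p hp => (hb _ p (Finset.mem_filter.1 hp).1).1)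
        fun p hp => (hb _ p (Finset.mem_filter.1 hp).1).2
  have h2 := h1.mul ((tendsto_prod_localSum_div k).comp hX)
  rw [mul_one] at h2
  refine h2.congr' ?_
  filter_upwards [hX.eventually_gt_atTop 1, hq] with i hi hqi
  exact (diagonalProd_div_mainTerm k hi hqi).symm

/-! ### Large prime factors of the modulus -/

theorem tendsto_sum_mertensWeight_rpow_sub {c : ℝ} (hc : 0 < c) :
    Tendsto (fun x : ℝ => ∑ p ∈ ⌊x ^ c⌋₊.primesLE, mertensWeight p -
      ∑ p ∈ ⌊x⌋₊.primesLE, mertensWeight p) atTop (𝓝 (Real.log c)) := by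
  have h := ((tendsto_sum_mertensWeight_sub_log_log.comp (tendsto_rpow_atTop hc)).sub
    tendsto_sum_mertensWeight_sub_log_log).add_const (Real.log c)
  rw [sub_self, zero_add] at h
  refine h.congr' ?_
  filter_upwards [eventually_gt_atTop 1] with x hx
  have hl : 0 < Real.log x := Real.log_pos hx
  simp only [Function.comp_apply]
  rw [Real.log_rpow (by linarith), Real.log_mul hc.ne' hl.ne']
  ring

/-- Up to Y, all primes are counted, whether or not they divide q. Beyond Y there are at most ω(q)
primes, each of weight at most 1/p + 2/p² ≤ 2/Y. -/
theorem sum_mertensWeight_large_le {X Y : ℝ} (hX : 1 ≤ X) (hXY : X ≤ Y) (q : ℕ) :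
    ∑ p ∈ q.primeFactors with ¬(p : ℕ) ≤ X, mertensWeight p ≤
      (∑ p ∈ ⌊Y⌋₊.primesLE, mertensWeight p - ∑ p ∈ ⌊X⌋₊.primesLE, mertensWeight p) +
        2 * (q.primeFactors.card / Y) := by
  have hY : 0 < Y := by linarith
  rw [← Finset.sum_filter_add_sum_filter_not _ (fun p : ℕ => (p : ℝ) ≤ Y)]
  refine add_le_add ?_ ?_
  · rw [← Finset.sum_sdiff_eq_sub (Nat.primesLE_mono (Nat.floor_le_floor hXY))]
    refine Finset.sum_le_sum_of_subset_of_nonneg ?_ fun p _ _ => mertensWeight_nonneg p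
    intro p hp
    simp only [Finset.mem_filter, Nat.mem_primeFactors] at hp
    simp only [Finset.mem_sdiff, Nat.mem_primesLE, Nat.le_floor_iff hY.le,
      Nat.le_floor_iff (by linarith : (0 : ℝ) ≤ X)]
    tauto
  · have hb : ∀ p ∈ (q.primeFactors.filter fun p : ℕ => ¬(p : ℝ) ≤ X).filter
        (fun p : ℕ => ¬(p : ℝ) ≤ Y),
        mertensWeight p ≤ 2 / Y := by
      intro p hp
      simp only [Finset.mem_filter, Nat.mem_primeFactors, not_le] at hp
      have hp' := hp.1.1.1
      have h1 := mertensWeight_le hp'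
      have hp0 : (0 : ℝ) < p := by exact_mod_cast hp'.pos
      have h2 : 2 * (1 / (p : ℝ) ^ 2) ≤ 1 / p := by
        have : (2 : ℝ) ≤ p := by exact_mod_cast hp'.two_le
        rw [mul_one_div, div_le_div_iff₀ (by positivity) hp0]
        nlinarith
      have h3 : 1 / (p : ℝ) ≤ 1 / Y := one_div_le_one_div_of_le hY hp.2.le
      have h4 : 2 / Y = 1 / Y + 1 / Y := by ring
      linarith
    refine (Finset.sum_le_card_nsmul _ _ _ hb).trans ?_
    rw [nsmul_eq_mul]
    have hc : ((((q.primeFactors.filter fun p : ℕ => ¬(p : ℝ) ≤ X).filter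
        (fun p : ℕ => ¬(p : ℝ) ≤ Y)).card : ℕ) : ℝ) ≤ q.primeFactors.card := by
      exact_mod_cast Finset.card_le_card
        ((Finset.filter_subset _ _).trans (Finset.filter_subset _ _))
    calc _ ≤ (q.primeFactors.card : ℝ) * (2 / Y) := by gcongr
      _ = _ := by ring

theorem isLittleO_rpow_of_lt {a b : ℝ} (hab : a < b) :
    (fun x : ℝ => x ^ a) =o[atTop] fun x : ℝ => x ^ b := by
  have h0 : ∀ᶠ x : ℝ in atTop, x ^ b ≠ 0 := by
    filter_upwards [eventually_gt_atTop 0] with x hx using (Real.rpow_pos_of_pos hx b).ne'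
  refine (isLittleO_iff_tendsto' (h0.mono fun x hx h => absurd h hx)).2 ?_
  refine (tendsto_rpow_neg_atTop (sub_pos.2 hab)).congr' ?_
  filter_upwards [eventually_gt_atTop 0] with x hx
  rw [← Real.rpow_sub hx, neg_sub]

theorem tendsto_sum_mertensWeight_large {ι : Type*} {l : Filter ι} {X : ι → ℝ} {q : ι → ℕ}
    (hX : Tendsto X l atTop)
    (hω : ∀ ε : ℝ, 0 < ε →
      (fun i => ((q i).primeFactors.card : ℝ)) =O[l] fun i => X i ^ (1 + ε)) :
    Tendsto (fun i => ∑ p ∈ (q i).primeFactors with ¬(p : ℕ) ≤ X i, mertensWeight p) l (𝓝 0) := by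
  have hnn : ∀ i, 0 ≤ ∑ p ∈ (q i).primeFactors with ¬(p : ℕ) ≤ X i, mertensWeight p :=
    fun i => Finset.sum_nonneg fun p _ => mertensWeight_nonneg p
  rw [Metric.tendsto_nhds]
  intro η hη
  -- With Y = X^(1+2ε), the primes in (X, Y] have total weight tending to log(1 + 2ε) ≤ 2ε = η/2 <
  -- η, and ω(q)/Y → 0 by the hypothesis at ε.
  set ε := η / 4 with hε
  have hε0 : 0 < ε := by positivity
  have h1 := (tendsto_sum_mertensWeight_rpow_sub (by linarith : 0 < 1 + 2 * ε)).comp hX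
  have h2 : Tendsto (fun i => ((q i).primeFactors.card : ℝ) / X i ^ (1 + 2 * ε)) l (𝓝 0) := by
    refine IsLittleO.tendsto_div_nhds_zero ((hω ε hε0).trans_isLittleO ?_)
    exact (isLittleO_rpow_of_lt (by linarith : 1 + ε < 1 + 2 * ε)).comp_tendsto hX
  have h3 := h1.add (h2.const_mul 2)
  rw [mul_zero, add_zero] at h3
  have hlt : Real.log (1 + 2 * ε) < η := by
    have := Real.log_le_sub_one_of_pos (by linarith : 0 < 1 + 2 * ε)
    linarith
  filter_upwards [h3.eventually (gt_mem_nhds hlt), hX.eventually_ge_atTop 1] with i hi hXi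
  rw [Real.dist_eq, sub_zero, abs_of_nonneg (hnn i)]
  refine lt_of_le_of_lt (sum_mertensWeight_large_le hXi ?_ (q i)) hi
  calc X i = X i ^ (1 : ℝ) := (Real.rpow_one _).symm
    _ ≤ X i ^ (1 + 2 * ε) := Real.rpow_le_rpow_of_exponent_le hXi (by linarith)

theorem isEquivalent_mainTerm_of_card_primeFactors (k : ℝ) {ι : Type*} {l : Filter ι} {X : ι → ℝ}
    {q : ι → ℕ} (hX : Tendsto X l atTop)
    (hω : ∀ ε : ℝ, 0 < ε →
      (fun i => ((q i).primeFactors.card : ℝ)) =O[l] fun i => X i ^ (1 + ε)) :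
    (fun i => mainTerm k (X i) (q i)) ~[l] fun i =>
      arithConst k * (∏ p ∈ (q i).primeFactors, (localSum k p)⁻¹) *
        (Real.exp Real.eulerMascheroniConstant * Real.log (X i)) ^ (k ^ 2) := by
  have hlog : Tendsto (fun i => ∑ p ∈ (q i).primeFactors with ¬(p : ℕ) ≤ X i,
      Real.log (localSum k p)) l (𝓝 0) := by
    have h := (tendsto_sum_mertensWeight_large hX hω).const_mul (k ^ 2)
    rw [mul_zero] at h
    refine squeeze_zero (fun i => Finset.sum_nonneg fun p hp => ?_) (fun i => ?_) h
    · exact log_localSum_nonneg k (Nat.prime_of_mem_primeFactors (Finset.mem_filter.1 hp).1)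
    · rw [Finset.mul_sum]
      exact Finset.sum_le_sum fun p hp =>
        log_localSum_le k (Nat.prime_of_mem_primeFactors (Finset.mem_filter.1 hp).1)
  have hexp := (Real.continuous_exp.tendsto 0).comp hlog
  rw [Real.exp_zero] at hexp
  refine isEquivalent_of_tendsto_one (hexp.congr' ?_)
  filter_upwards [hX.eventually_gt_atTop 1] with i hi
  have hpos : ∀ p ∈ (q i).primeFactors, 0 < localSum k p := fun p hp =>
    localSum_pos k (Nat.prime_of_mem_primeFactors hp)
  have hl : 0 < Real.log (X i) := Real.log_pos hi
  have ha := arithConst_pos k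
  have hE : 0 < (Real.exp Real.eulerMascheroniConstant * Real.log (X i)) ^ (k ^ 2) := by positivity
  have h1 : ∏ p ∈ (q i).primeFactors with (p : ℕ) ≤ X i, localSum k p ≠ 0 :=
    Finset.prod_ne_zero_iff.2 fun p hp => (hpos p (Finset.mem_filter.1 hp).1).ne'
  have h2 : ∏ p ∈ (q i).primeFactors with ¬(p : ℕ) ≤ X i, localSum k p ≠ 0 :=
    Finset.prod_ne_zero_iff.2 fun p hp => (hpos p (Finset.mem_filter.1 hp).1).ne'
  simp only [Function.comp_apply, Pi.div_apply]
  rw [← Real.log_prod fun p hp => (hpos p (Finset.mem_filter.1 hp).1).ne',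
    Real.exp_log (Finset.prod_pos fun p hp => hpos p (Finset.mem_filter.1 hp).1), mainTerm,
    Finset.prod_inv_distrib, Finset.prod_inv_distrib,
    ← Finset.prod_filter_mul_prod_filter_not (q i).primeFactors (fun p : ℕ => (p : ℝ) ≤ X i)
      (localSum k)]
  field_simp

/-! ### Orthogonality for primitive characters -/

/-- The sum of `χ(m) * conj χ(n)` over the primitive characters modulo `q`. -/
def primSum (q m n : ℕ) : ℂ :=
  ∑ χ ∈ primitiveChars q, χ (m : ZMod q) * (starRingEnd ℂ) (χ (n : ZMod q))

theorem mem_primitiveChars {q : ℕ} {χ : DirichletCharacter ℂ q} :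
    χ ∈ primitiveChars q ↔ χ.IsPrimitive := by
  simp [primitiveChars]

theorem norm_primSum_le_phiStar (q m n : ℕ) : ‖primSum q m n‖ ≤ phiStar q := by
  refine (norm_sum_le _ _).trans ?_
  refine (Finset.sum_le_card_nsmul _ _ 1 fun χ _ => ?_).trans (by simp [phiStar])
  rw [norm_mul, RCLike.norm_conj]
  exact mul_le_one₀ (χ.norm_le_one _) (norm_nonneg _) (χ.norm_le_one _)

theorem char_mul_conj_self {q n : ℕ} (h : n.Coprime q) (χ : DirichletCharacter ℂ q) :
    χ (n : ZMod q) * (starRingEnd ℂ) (χ (n : ZMod q)) = 1 := by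
  have h1 : ‖χ (n : ZMod q)‖ = 1 := by
    have := χ.unit_norm_eq_one (ZMod.unitOfCoprime n h)
    rwa [ZMod.coe_unitOfCoprime] at this
  rw [Complex.mul_conj, Complex.normSq_eq_norm_sq, h1]
  simp

theorem char_eq_zero_of_not_coprime {q n : ℕ} (h : ¬n.Coprime q) (χ : DirichletCharacter ℂ q) :
    χ (n : ZMod q) = 0 :=
  χ.map_nonunit fun hu => h ((ZMod.isUnit_iff_coprime n q).1 hu)

theorem primSum_self {q n : ℕ} (h : n.Coprime q) : primSum q n n = phiStar q := by
  simp [primSum, char_mul_conj_self h, phiStar]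

theorem primSum_eq_zero_of_not_coprime_left {q m : ℕ} (h : ¬m.Coprime q) (n : ℕ) :
    primSum q m n = 0 := by
  simp [primSum, char_eq_zero_of_not_coprime h]

theorem primSum_eq_zero_of_not_coprime_right {q n : ℕ} (h : ¬n.Coprime q) (m : ℕ) :
    primSum q m n = 0 := by
  simp [primSum, char_eq_zero_of_not_coprime h]

theorem sum_char_mul_conj {q : ℕ} [NeZero q] {m n : ℕ} (hn : n.Coprime q) :
    ∑ χ : DirichletCharacter ℂ q, χ (m : ZMod q) * (starRingEnd ℂ) (χ (n : ZMod q)) =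
      if (n : ZMod q) = m then (q.totient : ℂ) else 0 := by
  have hu : IsUnit (n : ZMod q) := (ZMod.isUnit_iff_coprime n q).2 hn
  rw [← DirichletCharacter.sum_char_inv_mul_char_eq ℂ hu (m : ZMod q)]
  refine Finset.sum_congr rfl fun χ _ => ?_
  rw [mul_comm]
  congr 1
  have h1 := char_mul_conj_self hn χ
  have h2 : χ (n : ZMod q) * χ (n : ZMod q)⁻¹ = 1 := by
    rw [← map_mul, ZMod.mul_inv_of_unit _ hu, map_one]
  have h0 : χ (n : ZMod q) ≠ 0 := left_ne_zero_of_mul_eq_one h1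
  exact mul_left_cancel₀ h0 (h1.trans h2.symm)

theorem changeLevel_apply_natCast {d q : ℕ} (hd : d ∣ q) (ψ : DirichletCharacter ℂ d) {n : ℕ}
    (hn : n.Coprime q) : DirichletCharacter.changeLevel hd ψ (n : ZMod q) = ψ (n : ZMod d) := by
  have := DirichletCharacter.changeLevel_eq_cast_of_dvd' ψ hd (a := (n : ℤ))
    (Nat.isCoprime_iff_coprime.2 hn)
  simpa using this

/-- Each character modulo q is induced by a unique primitive character, of modulus its conductor d ∣
q, with the same values at integers coprime to q. Grouping orthogonality modulo q by conductor gives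
the sum. -/
theorem sum_divisors_primSum {q : ℕ} (hq : q ≠ 0) {m n : ℕ} (hm : m.Coprime q) (hn : n.Coprime q) :
    ∑ d ∈ q.divisors, primSum d m n = if (n : ZMod q) = m then (q.totient : ℂ) else 0 := by
  classical
  have : NeZero q := ⟨hq⟩
  rw [← sum_char_mul_conj hn, ← Finset.sum_fiberwise_of_maps_to
    (s := (Finset.univ : Finset (DirichletCharacter ℂ q))) (t := q.divisors)
    (g := fun χ => χ.conductor)
    (fun χ _ => Nat.mem_divisors.2 ⟨χ.conductor_dvd_level, hq⟩)]
  refine Finset.sum_congr rfl fun d hd => ?_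
  have hdq := Nat.dvd_of_mem_divisors hd
  refine Finset.sum_bij (fun ψ _ => DirichletCharacter.changeLevel hdq ψ) ?_ ?_ ?_ ?_
  · intro ψ hψ
    rw [Finset.mem_filter, DirichletCharacter.conductor_changeLevel]
    exact ⟨Finset.mem_univ _, mem_primitiveChars.1 hψ⟩
  · intro ψ _ ψ' _ h
    exact DirichletCharacter.changeLevel_injective hdq h
  · intro χ hχ
    have hc : χ.conductor = d := (Finset.mem_filter.1 hχ).2
    subst hc
    exact ⟨χ.primitiveCharacter, mem_primitiveChars.2 χ.primitiveCharacter_isPrimitive,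
      χ.changeLevel_primitiveCharacter⟩
  · intro ψ _
    rw [changeLevel_apply_natCast hdq ψ hm, changeLevel_apply_natCast hdq ψ hn]

theorem primSum_eq_sum_moebius {q : ℕ} (hq : q ≠ 0) {m n : ℕ} (hm : m.Coprime q)
    (hn : n.Coprime q) :
    primSum q m n = ∑ x ∈ q.divisorsAntidiagonal, (ArithmeticFunction.moebius x.1 : ℂ) *
      (if (n : ZMod x.2) = m then (x.2.totient : ℂ) else 0) := by
  have h := (ArithmeticFunction.sum_eq_iff_sum_mul_moebius_eq_on (R := ℂ)
    (f := fun d => primSum d m n)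
    (g := fun d => if (n : ZMod d) = m then (d.totient : ℂ) else 0) {d | d ∣ q}
    (fun a b hab hb => hab.trans hb)).1 (fun d hd hdq =>
      sum_divisors_primSum hd.ne' (hm.coprime_dvd_right hdq) (hn.coprime_dvd_right hdq))
  exact (h q (Nat.pos_of_ne_zero hq) dvd_rfl).symm

/-- In the Möbius formula only moduli b dividing m - n survive. Dropping both the signs and the
condition b ∣ q leaves at most ∑ φ(b) over b ∣ |m - n|, which equals |m - n| ≤ mn. -/
theorem norm_primSum_le_mul {q m n : ℕ} (hq : q ≠ 0) (hm0 : m ≠ 0) (hn0 : n ≠ 0) (hmn : m ≠ n) :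
    ‖primSum q m n‖ ≤ m * n := by
  by_cases hm : m.Coprime q
  swap
  · rw [primSum_eq_zero_of_not_coprime_left hm, norm_zero]; positivity
  by_cases hn : n.Coprime q
  swap
  · rw [primSum_eq_zero_of_not_coprime_right hn, norm_zero]; positivity
  set D := ((m : ℤ) - n).natAbs with hD
  have hD0 : D ≠ 0 := by omega
  have hDle : D ≤ m * n := by
    have h1 : m ≤ m * n := Nat.le_mul_of_pos_right m (Nat.pos_of_ne_zero hn0)
    have h2 : n ≤ m * n := Nat.le_mul_of_pos_left n (Nat.pos_of_ne_zero hm0)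
    omega
  have hdvd : ∀ b : ℕ, (n : ZMod b) = m ↔ b ∣ D := by
    intro b
    have h := ZMod.intCast_eq_intCast_iff_dvd_sub (n : ℤ) (m : ℤ) b
    push_cast at h
    rw [h, hD, Int.natCast_dvd]
  rw [primSum_eq_sum_moebius hq hm hn]
  refine (norm_sum_le _ _).trans ?_
  have h1 : ∀ x ∈ q.divisorsAntidiagonal, ‖(ArithmeticFunction.moebius x.1 : ℂ) *
      (if (n : ZMod x.2) = m then (x.2.totient : ℂ) else 0)‖ ≤
      if x.2 ∣ D then (x.2.totient : ℝ) else 0 := by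
    intro x _
    have hμ : ‖(ArithmeticFunction.moebius x.1 : ℂ)‖ ≤ 1 := by
      rw [Complex.norm_intCast]
      exact_mod_cast ArithmeticFunction.abs_moebius_le_one
    simp only [hdvd]
    split_ifs
    · rw [norm_mul, Complex.norm_natCast]
      exact mul_le_of_le_one_left (by positivity) hμ
    · simp
  refine (Finset.sum_le_sum h1).trans ?_
  rw [Nat.sum_divisorsAntidiagonal' (f := fun _ b => if b ∣ D then (b.totient : ℝ) else 0),
    ← Finset.sum_filter]
  have h2 : ∑ b ∈ q.divisors with b ∣ D, (b.totient : ℝ) ≤ ∑ b ∈ D.divisors, (b.totient : ℝ) := by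
    refine Finset.sum_le_sum_of_subset_of_nonneg (fun b hb => ?_) fun _ _ _ => by positivity
    exact Nat.mem_divisors.2 ⟨(Finset.mem_filter.1 hb).2, hD0⟩
  refine h2.trans ?_
  have h3 : ∑ b ∈ D.divisors, (b.totient : ℝ) = D := by exact_mod_cast Nat.sum_totient D
  rw [h3]
  exact_mod_cast hDle

/-! ### A lower bound for the number of primitive characters -/

theorem sum_divisors_phiStar {q : ℕ} (hq : q ≠ 0) :
    ∑ d ∈ q.divisors, (phiStar d : ℤ) = q.totient := by
  have h := sum_divisors_primSum hq (Nat.coprime_one_left q) (Nat.coprime_one_left q)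
  rw [if_pos rfl, Finset.sum_congr rfl fun d _ => primSum_self (Nat.coprime_one_left d)] at h
  exact_mod_cast h

/-- Euler's totient as an arithmetic function. -/
def totientArith : ArithmeticFunction ℤ := ⟨fun n => n.totient, by simp⟩

theorem isMultiplicative_totientArith : totientArith.IsMultiplicative :=
  ⟨by simp [totientArith], fun {m n} h => by
    simp [totientArith, Nat.totient_mul h]⟩

theorem phiStar_eq_moebius_mul_totientArith {q : ℕ} (hq : q ≠ 0) :
    (phiStar q : ℤ) = (ArithmeticFunction.moebius * totientArith) q := by
  have h := (ArithmeticFunction.sum_eq_iff_sum_mul_moebius_eq (R := ℤ)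
    (f := fun d => (phiStar d : ℤ)) (g := fun d => (d.totient : ℤ))).1
    (fun d hd => sum_divisors_phiStar hd.ne')
  rw [ArithmeticFunction.mul_apply, ← h q (Nat.pos_of_ne_zero hq)]
  simp [totientArith]

theorem phiStar_eq_prod {q : ℕ} (hq : q ≠ 0) :
    (phiStar q : ℤ) = ∏ p ∈ q.primeFactors, (phiStar (p ^ q.factorization p) : ℤ) := by
  have hF := ArithmeticFunction.isMultiplicative_moebius.mul isMultiplicative_totientArith
  rw [phiStar_eq_moebius_mul_totientArith hq, hF.multiplicative_factorization _ hq,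
    Nat.prod_factorization_eq_prod_primeFactors]
  refine Finset.prod_congr rfl fun p hp => ?_
  rw [phiStar_eq_moebius_mul_totientArith
    (pow_ne_zero _ (Nat.prime_of_mem_primeFactors hp).ne_zero)]

theorem phiStar_prime_pow {p : ℕ} (hp : p.Prime) (v : ℕ) :
    (phiStar (p ^ (v + 1)) : ℤ) = (p ^ (v + 1)).totient - (p ^ v).totient := by
  have h1 := sum_divisors_phiStar (pow_ne_zero (v + 1) hp.ne_zero)
  have h2 := sum_divisors_phiStar (pow_ne_zero v hp.ne_zero)
  rw [Nat.sum_divisors_prime_pow hp] at h1 h2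
  rw [Finset.sum_range_succ, h2] at h1
  linarith

/-- Here φ*(p) = p - 2 and φ*(p^v) = p^(v-2) (p-1)² for v ≥ 2. The extra constants are needed only
at 4 ≤ 4·1² and 3 ≤ 3·1²; the modulus 2 is excluded because φ*(2) = 0. -/
theorem prime_pow_le_phiStar_sq {p : ℕ} (hp : p.Prime) {v : ℕ} (hv : v ≠ 0)
    (h0 : (phiStar (p ^ v) : ℤ) ≠ 0) :
    ((p ^ v : ℕ) : ℤ) ≤ ((if p = 2 then 4 else 1) * if p = 3 then 3 else 1) *
      (phiStar (p ^ v) : ℤ) ^ 2 := by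
  have h2 : (2 : ℤ) ≤ p := by exact_mod_cast hp.two_le
  obtain ⟨v, rfl⟩ := Nat.exists_eq_succ_of_ne_zero hv
  rw [Nat.succ_eq_add_one] at *
  rcases v with _ | w
  · have e : (phiStar (p ^ (0 + 1)) : ℤ) = p - 2 := by
      rw [phiStar_prime_pow hp, zero_add, pow_one, pow_zero, Nat.totient_prime hp,
        Nat.totient_one, Nat.cast_sub hp.one_le]
      push_cast
      ring
    rw [e] at h0 ⊢
    have hp2 : p ≠ 2 := by rintro rfl; simp at h0
    rw [zero_add, pow_one, if_neg hp2]
    split_ifs with h3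
    · subst h3; norm_num
    · have h4 : (4 : ℤ) ≤ p := by
        have := hp.two_le
        have : 4 ≤ p := by omega
        exact_mod_cast this
      nlinarith
  · have e : (phiStar (p ^ (w + 1 + 1)) : ℤ) = p ^ w * (p - 1) ^ 2 := by
      rw [phiStar_prime_pow hp, Nat.totient_prime_pow_succ hp, Nat.totient_prime_pow_succ hp]
      push_cast [Nat.cast_sub hp.one_le]
      ring
    rw [e]
    push_cast
    have hw : (1 : ℤ) ≤ (p : ℤ) ^ w := one_le_pow₀ (by linarith)
    have key : (p : ℤ) ^ 2 ≤ ((if p = 2 then 4 else 1) * if p = 3 then 3 else 1) *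
        (((p : ℤ) - 1) ^ 2) ^ 2 := by
      by_cases hp2 : p = 2
      · subst hp2; norm_num
      · have h3 : (3 : ℤ) ≤ p := by
          have := hp.two_le
          have : 3 ≤ p := by omega
          exact_mod_cast this
        have h5 : (p : ℤ) ≤ ((p : ℤ) - 1) ^ 2 := by nlinarith
        have h6 : (p : ℤ) ^ 2 ≤ (((p : ℤ) - 1) ^ 2) ^ 2 := pow_le_pow_left₀ (by linarith) h5 2
        rw [if_neg hp2]
        split_ifs <;> nlinarith [sq_nonneg (((p : ℤ) - 1) ^ 2)]
    calc (p : ℤ) ^ (w + 1 + 1) = p ^ w * p ^ 2 := by ring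
      _ ≤ (p ^ w * p ^ w) * p ^ 2 := by
          refine mul_le_mul_of_nonneg_right ?_ (by positivity)
          nlinarith
      _ ≤ (p ^ w * p ^ w) * (((if p = 2 then 4 else 1) * if p = 3 then 3 else 1) *
        (((p : ℤ) - 1) ^ 2) ^ 2) := mul_le_mul_of_nonneg_left key (by positivity)
      _ = _ := by ring

/-- Multiplicativity reduces this to prime powers; 12 = 4·3 collects the exceptional constants at 2
and 3. -/
theorem le_twelve_mul_phiStar_sq {q : ℕ} (hq : q ≠ 0) (h : 0 < phiStar q) :
    (q : ℝ) ≤ 12 * (phiStar q : ℝ) ^ 2 := by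
  have h0 : (phiStar q : ℤ) ≠ 0 := by exact_mod_cast h.ne'
  have hprod := phiStar_eq_prod hq
  have hne : ∀ p ∈ q.primeFactors, (phiStar (p ^ q.factorization p) : ℤ) ≠ 0 := by
    rw [hprod] at h0
    exact Finset.prod_ne_zero_iff.1 h0
  have hq' : (q : ℤ) = ∏ p ∈ q.primeFactors, ((p ^ q.factorization p : ℕ) : ℤ) := by
    conv_lhs => rw [← Nat.prod_factorization_pow_eq_self hq]
    rw [Nat.prod_factorization_eq_prod_primeFactors]
    push_cast
    rfl
  have hle : (q : ℤ) ≤ 12 * (phiStar q : ℤ) ^ 2 := by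
    rw [hprod]
    calc (q : ℤ) = ∏ p ∈ q.primeFactors, ((p ^ q.factorization p : ℕ) : ℤ) := hq'
      _ ≤ ∏ p ∈ q.primeFactors, ((if p = 2 then 4 else 1) * if p = 3 then 3 else 1) *
          (phiStar (p ^ q.factorization p) : ℤ) ^ 2 := by
          refine Finset.prod_le_prod (fun _ _ => by positivity) fun p hp => ?_
          have hp' := Nat.prime_of_mem_primeFactors hp
          refine prime_pow_le_phiStar_sq hp' ?_ (hne p hp)
          exact (hp'.factorization_pos_of_dvd hq (Nat.dvd_of_mem_primeFactors hp)).ne'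
      _ ≤ _ := by
          rw [Finset.prod_mul_distrib, Finset.prod_mul_distrib, Finset.prod_pow]
          refine mul_le_mul_of_nonneg_right ?_ (sq_nonneg _)
          simp only [Finset.prod_ite_eq']
          split_ifs <;> norm_num
  exact_mod_cast hle

/-! ### The Dirichlet series of `P_X ^ k` -/

/-- The multiplicative coefficients of the Dirichlet series of `P_X ^ k`, where `N = ⌊X⌋`. -/
def smoothCoeff (k : ℝ) (N n : ℕ) : ℝ :=
  n.factorization.prod fun p m => expCoeff k (Nat.log p N) m

theorem smoothCoeff_one (k : ℝ) (N : ℕ) : smoothCoeff k N 1 = 1 := by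
  simp [smoothCoeff]

theorem smoothCoeff_mul (k : ℝ) (N : ℕ) {m n : ℕ} (h : m.Coprime n) :
    smoothCoeff k N (m * n) = smoothCoeff k N m * smoothCoeff k N n := by
  rw [smoothCoeff, Nat.factorization_mul_of_coprime h,
    Finsupp.prod_add_index_of_disjoint (by simpa using h.disjoint_primeFactors)]
  rfl

theorem smoothCoeff_prime_pow (k : ℝ) (N : ℕ) {p : ℕ} (hp : p.Prime) (m : ℕ) :
    smoothCoeff k N (p ^ m) = expCoeff k (Nat.log p N) m := by
  rw [smoothCoeff, hp.factorization_pow, Finsupp.prod_single_index (by exact expCoeff_zero _ _)]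

theorem smoothCoeff_nonneg {k : ℝ} (hk : 0 ≤ k) (N n : ℕ) : 0 ≤ smoothCoeff k N n := by
  unfold smoothCoeff Finsupp.prod
  exact Finset.prod_nonneg fun _ _ => expCoeff_nonneg hk _ _

/-- Only prime powers contribute, and Λ(p^r)/log p^r = 1/r. -/
theorem sum_vonMangoldt_div_log (h : ℕ → ℂ) (N : ℕ) :
    ∑ p ∈ N.primesLE, ∑ j ∈ Finset.range (Nat.log p N), h (p ^ (j + 1)) / (j + 1) =
      ∑ n ∈ Finset.Icc 1 N, ((ArithmeticFunction.vonMangoldt n / Real.log n : ℝ) : ℂ) * h n := by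
  rw [Finset.sum_sigma']
  refine Finset.sum_of_injOn (fun x => x.1 ^ (x.2 + 1)) ?_ ?_ ?_ ?_
  · rintro ⟨p, j⟩ hx ⟨p', j'⟩ hx' he
    simp only [Finset.coe_sigma, Set.mem_sigma_iff, Finset.mem_coe, Nat.mem_primesLE] at hx hx'
    obtain ⟨h1, h2⟩ := hx.1.2.pow_inj' hx'.1.2 (Nat.succ_ne_zero j) (Nat.succ_ne_zero j') he
    subst h1
    simp only [Nat.succ_eq_add_one, add_left_inj] at h2
    rw [h2]
  · rintro ⟨p, j⟩ hx
    simp only [Finset.coe_sigma, Set.mem_sigma_iff, Finset.mem_coe, Nat.mem_primesLE,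
      Finset.mem_range] at hx
    refine Finset.mem_coe.2 (Finset.mem_Icc.2 ⟨Nat.one_le_pow _ _ hx.1.2.pos, ?_⟩)
    have hN : N ≠ 0 := by have := hx.1.2.pos; omega
    exact Nat.pow_le_of_le_log hN hx.2
  · intro n hn hni
    have hn' := Finset.mem_Icc.1 hn
    suffices h0 : ArithmeticFunction.vonMangoldt n = 0 by simp [h0]
    by_contra hne
    rw [← Ne, ArithmeticFunction.vonMangoldt_ne_zero_iff] at hne
    obtain ⟨p, r, hp, hr, rfl⟩ := hne
    have hp' := hp.nat_prime
    refine hni ⟨⟨p, r - 1⟩, ?_, ?_⟩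
    · simp only [Finset.coe_sigma, Set.mem_sigma_iff, Finset.mem_coe, Nat.mem_primesLE,
        Finset.mem_range]
      have hlog := Nat.le_log_of_pow_le hp'.one_lt hn'.2
      exact ⟨⟨(Nat.le_self_pow hr.ne' p).trans hn'.2, hp'⟩, by omega⟩
    · simp only [Nat.sub_add_cancel hr]
  · rintro ⟨p, j⟩ hx
    have hp := (Nat.mem_primesLE.1 (Finset.mem_sigma.1 hx).1).2
    have hl : Real.log p ≠ 0 := (Real.log_pos (by exact_mod_cast hp.one_lt)).ne'
    have e : ArithmeticFunction.vonMangoldt (p ^ (j + 1)) / Real.log ((p ^ (j + 1) : ℕ) : ℝ) =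
        1 / ((j : ℝ) + 1) := by
      rw [ArithmeticFunction.vonMangoldt_apply_pow (Nat.succ_ne_zero j),
        ArithmeticFunction.vonMangoldt_apply_prime hp, Nat.cast_pow, Real.log_pow]
      push_cast
      field_simp
    simp only [e]
    push_cast
    ring

/-- There are finitely many primes and each local factor is entire, so the Euler product converges
absolutely with no bound on g. It serves both for g(n) = χ(n)/√n and for the Rankin weights n^s. -/
theorem summable_and_hasSum_smoothCoeff (k : ℝ) (N : ℕ) {g : ℕ → ℂ} (h1 : g 1 = 1)
    (hmul : ∀ m n, g (m * n) = g m * g n) :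
    (Summable fun n : Nat.smoothNumbers (N + 1) => ‖(smoothCoeff k N n : ℂ) * g n‖) ∧
    HasSum (fun n : Nat.smoothNumbers (N + 1) => (smoothCoeff k N n : ℂ) * g n)
      (Complex.exp (k * ∑ n ∈ Finset.Icc 1 N,
        ((ArithmeticFunction.vonMangoldt n / Real.log n : ℝ) : ℂ) * g n)) := by
  have hpow : ∀ a m, g (a ^ m) = g a ^ m := by
    intro a m
    induction m with
    | zero => simp [h1]
    | succ m ih => rw [pow_succ, hmul, ih, pow_succ]
  have hloc : ∀ {p : ℕ}, p.Prime → HasSum (fun m => (smoothCoeff k N (p ^ m) : ℂ) * g (p ^ m))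
      (Complex.exp (k * ∑ j ∈ Finset.range (Nat.log p N), g p ^ (j + 1) / (j + 1))) := by
    intro p hp
    simp only [smoothCoeff_prime_pow k N hp, hpow]
    exact hasSum_expCoeff k _ (g p)
  have h := EulerProduct.summable_and_hasSum_smoothNumbers_prod_primesBelow_tsum
    (f := fun n => (smoothCoeff k N n : ℂ) * g n) (by simp [smoothCoeff_one, h1])
    (fun {m n} hmn => by simp only [smoothCoeff_mul k N hmn, hmul]; push_cast; ring)
    (fun {p} hp => (hloc hp).summable.norm) (N + 1)
  have e : Complex.exp (k * ∑ n ∈ Finset.Icc 1 N,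
      ((ArithmeticFunction.vonMangoldt n / Real.log n : ℝ) : ℂ) * g n) =
      ∏ p ∈ (N + 1).primesBelow, ∑' m : ℕ, (smoothCoeff k N (p ^ m) : ℂ) * g (p ^ m) := by
    rw [← sum_vonMangoldt_div_log, Finset.mul_sum, Complex.exp_sum]
    refine Finset.prod_congr rfl fun p hp => ?_
    rw [(hloc (Nat.prime_of_mem_primesLE hp)).tsum_eq]
    simp only [hpow]
  rw [e]
  exact h

theorem hasSum_smoothCoeff_rpow (k : ℝ) (N : ℕ) (s : ℝ) :
    HasSum (fun n : Nat.smoothNumbers (N + 1) => smoothCoeff k N n * ((n : ℕ) : ℝ) ^ s)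
      (Real.exp (k * ∑ n ∈ Finset.Icc 1 N,
        ArithmeticFunction.vonMangoldt n / Real.log n * (n : ℝ) ^ s)) := by
  have h := (summable_and_hasSum_smoothCoeff k N (g := fun n => (((n : ℝ) ^ s : ℝ) : ℂ))
    (by simp) fun m n => by
      rw [Nat.cast_mul, Real.mul_rpow m.cast_nonneg n.cast_nonneg]; push_cast; rfl).2
  rw [← Complex.hasSum_ofReal]
  convert h using 1
  · funext n; push_cast; rfl
  · push_cast; rfl

theorem hasSum_smoothCoeff_sq {k : ℝ} (hk : 0 ≤ k) (N q : ℕ) :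
    HasSum (fun n : Nat.smoothNumbers (N + 1) =>
      if (n : ℕ).Coprime q then smoothCoeff k N n ^ 2 / ((n : ℕ) : ℝ) else 0)
      (diagonalProd k N q) := by
  let f : ℕ → ℝ := fun n => if n.Coprime q then smoothCoeff k N n ^ 2 / (n : ℝ) else 0
  have hloc : ∀ {p : ℕ}, p.Prime → HasSum (fun m => f (p ^ m))
      (if ¬p ∣ q then truncLocalSum k (Nat.log p N) p else 1) := by
    intro p hp
    by_cases hpq : p ∣ q
    · rw [if_neg (not_not.2 hpq)]
      have := hasSum_single (f := fun m => f (p ^ m)) 0 fun m hm => by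
        simp only [f]
        rw [if_neg]
        intro hc
        exact (Nat.Prime.coprime_iff_not_dvd hp).1 ((Nat.coprime_pow_left_iff
          (Nat.pos_of_ne_zero hm) p q).1 hc) hpq
      simpa [f, smoothCoeff_one] using this
    · rw [if_pos hpq]
      refine (summable_expCoeff_sq hk (Nat.log p N) hp).hasSum.congr_fun fun m => ?_
      simp only [f]
      rw [if_pos (((Nat.Prime.coprime_iff_not_dvd hp).2 hpq).pow_left m),
        smoothCoeff_prime_pow k N hp, Nat.cast_pow]
  have h := EulerProduct.summable_and_hasSum_smoothNumbers_prod_primesBelow_tsum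
    (f := f) (by simp [f, smoothCoeff_one])
    (fun {m n} hmn => by
      simp only [f, Nat.coprime_mul_iff_left, smoothCoeff_mul k N hmn]
      by_cases hm : m.Coprime q
      · by_cases hn : n.Coprime q
        · rw [if_pos ⟨hm, hn⟩, if_pos hm, if_pos hn]
          push_cast
          ring
        · rw [if_neg fun h => hn h.2, if_neg hn, mul_zero]
      · rw [if_neg fun h => hm h.1, if_neg hm, zero_mul])
    (fun {p} hp => (hloc hp).summable.norm) (N + 1)
  have e : diagonalProd k N q = ∏ p ∈ (N + 1).primesBelow, ∑' m : ℕ, f (p ^ m) := by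
    rw [diagonalProd, Finset.prod_filter]
    exact Finset.prod_congr rfl fun p hp => ((hloc (Nat.prime_of_mem_primesLE hp)).tsum_eq).symm
  rw [e]
  exact h.2

/-! ### Comparison of the moment with its diagonal -/

/-- For real k, both sides are exp(2k Re z) with z the exponent of P_X(χ). -/
theorem norm_eulerP_rpow {q : ℕ} (k X : ℝ) (χ : DirichletCharacter ℂ q) :
    ‖eulerP X χ‖ ^ (2 * k) = ‖Complex.exp (k * ∑ n ∈ Finset.Icc 1 ⌊X⌋₊,
      ((ArithmeticFunction.vonMangoldt n / Real.log n : ℝ) : ℂ) *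
        (χ (n : ZMod q) / (Real.sqrt n : ℂ)))‖ ^ 2 := by
  have e : ∑ n ∈ Finset.Icc 1 ⌊X⌋₊, (ArithmeticFunction.vonMangoldt n : ℂ) * χ (n : ZMod q) /
      ((Real.sqrt n : ℂ) * (Real.log n : ℂ)) = ∑ n ∈ Finset.Icc 1 ⌊X⌋₊,
      ((ArithmeticFunction.vonMangoldt n / Real.log n : ℝ) : ℂ) *
        (χ (n : ZMod q) / (Real.sqrt n : ℂ)) :=
    Finset.sum_congr rfl fun n _ => by
      rw [Complex.ofReal_div, div_mul_div_comm, mul_comm (Real.log n : ℂ)]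
  rw [eulerP, e, Complex.norm_exp, Complex.norm_exp, ← Real.exp_mul, ← Real.exp_nat_mul,
    Complex.re_ofReal_mul]
  push_cast
  ring_nf

theorem hasSum_prod_mul {ι : Type*} {f g : ι → ℂ} {V W : ℂ} (hf : HasSum f V) (hg : HasSum g W)
    (hfn : Summable fun i => ‖f i‖) (hgn : Summable fun i => ‖g i‖) :
    HasSum (fun x : ι × ι => f x.1 * g x.2) (V * W) :=
  hf.mul hg (summable_mul_of_summable_norm hfn hgn)

theorem hasSum_mul_conj {ι : Type*} {f : ι → ℂ} {V : ℂ} (hf : HasSum f V)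
    (hn : Summable fun i => ‖f i‖) :
    HasSum (fun x : ι × ι => f x.1 * (starRingEnd ℂ) (f x.2)) (V * (starRingEnd ℂ) V) :=
  hasSum_prod_mul (g := fun i => (starRingEnd ℂ) (f i)) hf (Complex.hasSum_conj'.2 hf) hn
    (by simpa only [RCLike.norm_conj] using hn)

theorem mul_conj_eq_norm_sq (V : ℂ) : V * (starRingEnd ℂ) V = ((‖V‖ ^ 2 : ℝ) : ℂ) := by
  rw [Complex.mul_conj, Complex.normSq_eq_norm_sq]

theorem hasSum_moment (k X : ℝ) (q : ℕ) :
    HasSum (fun x : Nat.smoothNumbers (⌊X⌋₊ + 1) × Nat.smoothNumbers (⌊X⌋₊ + 1) =>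
      ((smoothCoeff k ⌊X⌋₊ x.1 * smoothCoeff k ⌊X⌋₊ x.2 /
        (Real.sqrt (x.1 : ℕ) * Real.sqrt (x.2 : ℕ)) : ℝ) : ℂ) *
        (primSum q x.1 x.2 / phiStar q)) (moment k X q) := by
  set N := ⌊X⌋₊
  have hχ : ∀ χ : DirichletCharacter ℂ q,
      HasSum (fun x : Nat.smoothNumbers (N + 1) × Nat.smoothNumbers (N + 1) =>
        ((smoothCoeff k N x.1 * smoothCoeff k N x.2 /
          (Real.sqrt (x.1 : ℕ) * Real.sqrt (x.2 : ℕ)) : ℝ) : ℂ) *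
          (χ ((x.1 : ℕ) : ZMod q) * (starRingEnd ℂ) (χ ((x.2 : ℕ) : ZMod q))))
        ((‖eulerP X χ‖ ^ (2 * k) : ℝ) : ℂ) := by
    intro χ
    have h := summable_and_hasSum_smoothCoeff k N (g := fun n => χ (n : ZMod q) / (Real.sqrt n : ℂ))
      (by simp) fun m n => by
        rw [Nat.cast_mul, Nat.cast_mul, map_mul, Real.sqrt_mul m.cast_nonneg]
        push_cast
        rw [div_mul_div_comm]
    have hm := hasSum_mul_conj h.2 h.1
    rw [mul_conj_eq_norm_sq, ← norm_eulerP_rpow k X χ] at hm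
    refine hm.congr_fun fun x => ?_
    simp only [map_mul, map_div₀, Complex.conj_ofReal]
    push_cast
    ring
  have hs := (hasSum_sum fun χ (_ : χ ∈ primitiveChars q) => hχ χ).mul_left
    (1 / (phiStar q : ℂ))
  have e : ((moment k X q : ℝ) : ℂ) =
      1 / (phiStar q : ℂ) * ∑ χ ∈ primitiveChars q, ((‖eulerP X χ‖ ^ (2 * k) : ℝ) : ℂ) := by
    rw [moment]; push_cast; rfl
  rw [e]
  refine hs.congr_fun fun x => ?_
  rw [← Finset.mul_sum, primSum]
  ring

/-- For m ≠ n the character sum is at most both mn and φ*(q), hence at most (mn)^η φ*(q)^(1-η). With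
this weight the double sum splits into the square of ∑ c(n) n^(η-1/2), an Euler product with an
explicit exponential. -/
theorem abs_moment_sub_diagonalProd_le {k : ℝ} (hk : 0 ≤ k) (X : ℝ) {q : ℕ} (hq : q ≠ 0)
    (hφ : 0 < phiStar q) {η : ℝ} (h0 : 0 ≤ η) (h1 : η ≤ 1) :
    |moment k X q - diagonalProd k ⌊X⌋₊ q| ≤ (phiStar q : ℝ) ^ (-η) *
      Real.exp (k * ∑ n ∈ Finset.Icc 1 ⌊X⌋₊,
        ArithmeticFunction.vonMangoldt n / Real.log n * (n : ℝ) ^ (η - 1 / 2)) ^ 2 := by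
  set N := ⌊X⌋₊
  have hφ' : (0 : ℝ) < phiStar q := by exact_mod_cast hφ
  have hdiag : HasSum (fun x : Nat.smoothNumbers (N + 1) × Nat.smoothNumbers (N + 1) =>
      if x.1 = x.2 then (if (x.1 : ℕ).Coprime q then
        smoothCoeff k N x.1 ^ 2 / ((x.1 : ℕ) : ℝ) else 0) else 0) (diagonalProd k N q) := by
    have hinj : Function.Injective fun n : Nat.smoothNumbers (N + 1) => (n, n) :=
      fun a b hab => (Prod.mk.inj hab).1
    rw [← hinj.hasSum_iff]
    · simpa [Function.comp_def] using hasSum_smoothCoeff_sq hk N q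
    · rintro ⟨a, b⟩ hx
      rw [if_neg]
      intro hab
      exact hx ⟨a, Prod.ext rfl hab⟩
  have hE := (hasSum_moment k X q).sub (Complex.hasSum_ofReal.2 hdiag)
  have hT := hasSum_smoothCoeff_rpow k N (η - 1 / 2)
  have hT2 := (hT.mul hT (hT.summable.mul_of_nonneg hT.summable
    (fun n => mul_nonneg (smoothCoeff_nonneg hk N n) (by positivity))
    (fun n => mul_nonneg (smoothCoeff_nonneg hk N n) (by positivity)))).mul_left
      ((phiStar q : ℝ) ^ (-η))
  have hb := hE.norm_le_of_bounded hT2 fun x => ?_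
  · rw [← Complex.ofReal_sub, Complex.norm_real, Real.norm_eq_abs] at hb
    rwa [pow_two]
  · obtain ⟨⟨m, hm⟩, ⟨n, hn⟩⟩ := x
    have hm0 : m ≠ 0 := Nat.ne_zero_of_mem_smoothNumbers hm
    have hn0 : n ≠ 0 := Nat.ne_zero_of_mem_smoothNumbers hn
    have hmp : (0 : ℝ) < m := by exact_mod_cast Nat.pos_of_ne_zero hm0
    have hnp : (0 : ℝ) < n := by exact_mod_cast Nat.pos_of_ne_zero hn0
    have ham := smoothCoeff_nonneg hk N m
    have han := smoothCoeff_nonneg hk N n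
    simp only [Subtype.mk.injEq]
    by_cases hmn : m = n
    · subst hmn
      -- The diagonal terms match exactly; both vanish when m is not coprime to q.
      have hz : ((smoothCoeff k N m * smoothCoeff k N m /
          (Real.sqrt m * Real.sqrt m) : ℝ) : ℂ) * (primSum q m m / phiStar q) -
          ((if m = m then (if m.Coprime q then smoothCoeff k N m ^ 2 / (m : ℝ) else 0) else 0 : ℝ)
            : ℂ) = 0 := by
        rw [if_pos rfl, Real.mul_self_sqrt hmp.le]
        by_cases hc : m.Coprime q
        · have : (phiStar q : ℂ) ≠ 0 := by exact_mod_cast hφ.ne'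
          rw [if_pos hc, primSum_self hc, div_self this, mul_one, pow_two, sub_self]
        · rw [if_neg hc, primSum_eq_zero_of_not_coprime_left hc]
          simp
      rw [hz, norm_zero]
      positivity
    · rw [if_neg hmn, Complex.ofReal_zero, sub_zero, norm_mul, Complex.norm_real,
        Real.norm_of_nonneg (by positivity), norm_div, Complex.norm_natCast]
      have hG : ‖primSum q m n‖ / phiStar q ≤ (phiStar q : ℝ) ^ (-η) * ((m : ℝ) * n) ^ η := by
        have hA := norm_primSum_le_mul hq hm0 hn0 hmn
        have hB := norm_primSum_le_phiStar q m n
        set G := ‖primSum q m n‖ with hGdef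
        have hG0 : 0 ≤ G := norm_nonneg _
        have hsplit : G ≤ ((m : ℝ) * n) ^ η * (phiStar q : ℝ) ^ (1 - η) := by
          calc G = G ^ η * G ^ (1 - η) := by
                rw [← Real.rpow_add_of_nonneg hG0 h0 (by linarith)]; simp
            _ ≤ _ := by
                refine mul_le_mul (Real.rpow_le_rpow hG0 hA h0)
                  (Real.rpow_le_rpow hG0 hB (by linarith)) (by positivity) (by positivity)
        rw [div_le_iff₀ hφ']
        refine hsplit.trans (le_of_eq ?_)
        rw [sub_eq_neg_add, Real.rpow_add hφ', Real.rpow_one]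
        ring
      refine (mul_le_mul_of_nonneg_left hG (by positivity)).trans (le_of_eq ?_)
      rw [Real.mul_rpow hmp.le hnp.le, Real.rpow_sub hmp, Real.rpow_sub hnp, ← Real.sqrt_eq_rpow,
        ← Real.sqrt_eq_rpow]
      ring

theorem sum_one_div_sqrt_le (N : ℕ) :
    ∑ n ∈ Finset.Icc 1 N, 1 / Real.sqrt n ≤ 2 * Real.sqrt N := by
  induction N with
  | zero => simp
  | succ N ih =>
    rw [Finset.sum_Icc_succ_top (by omega)]
    have h1 : 0 < Real.sqrt ((N + 1 : ℕ) : ℝ) := Real.sqrt_pos.2 (by positivity)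
    have h2 : Real.sqrt N ≤ Real.sqrt ((N + 1 : ℕ) : ℝ) := Real.sqrt_le_sqrt (by push_cast; linarith)
    have h3 := Real.sq_sqrt (by positivity : (0 : ℝ) ≤ ((N + 1 : ℕ) : ℝ))
    have h4 := Real.sq_sqrt (by positivity : (0 : ℝ) ≤ (N : ℝ))
    have h5 : 1 / Real.sqrt ((N + 1 : ℕ) : ℝ) ≤
        2 * (Real.sqrt ((N + 1 : ℕ) : ℝ) - Real.sqrt N) := by
      rw [div_le_iff₀ h1]
      push_cast at h3 h2 h1 ⊢
      nlinarith [sq_nonneg (Real.sqrt ((N : ℝ) + 1) - Real.sqrt N)]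
    linarith

theorem sum_vonMangoldt_rpow_le {X : ℝ} (hX : 0 ≤ X) {η : ℝ} (h0 : 0 ≤ η) :
    ∑ n ∈ Finset.Icc 1 ⌊X⌋₊, ArithmeticFunction.vonMangoldt n / Real.log n * (n : ℝ) ^ (η - 1 / 2) ≤
      2 * X ^ (1 / 2 + η) := by
  have hfl := Nat.floor_le hX
  have h1 : ∀ n ∈ Finset.Icc 1 ⌊X⌋₊,
      ArithmeticFunction.vonMangoldt n / Real.log n * (n : ℝ) ^ (η - 1 / 2) ≤
        X ^ η * (1 / Real.sqrt n) := by
    intro n hn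
    have hn' := Finset.mem_Icc.1 hn
    have hn0 : (0 : ℝ) < n := by exact_mod_cast hn'.1
    have hnX : (n : ℝ) ≤ X := le_trans (by exact_mod_cast hn'.2) hfl
    rw [Real.rpow_sub hn0, ← Real.sqrt_eq_rpow, div_eq_mul_one_div _ (Real.sqrt n)]
    -- Λ(n)/log n ≤ 1, also at n = 1, where the quotient is 0/0 = 0.
    refine (mul_le_of_le_one_left (by positivity) (div_le_one_of_le₀
      ArithmeticFunction.vonMangoldt_le_log (Real.log_natCast_nonneg n))).trans ?_
    gcongr
  refine (Finset.sum_le_sum h1).trans ?_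
  rw [← Finset.mul_sum]
  have h2 := sum_one_div_sqrt_le ⌊X⌋₊
  have h3 : Real.sqrt ⌊X⌋₊ ≤ Real.sqrt X := Real.sqrt_le_sqrt hfl
  calc X ^ η * ∑ n ∈ Finset.Icc 1 ⌊X⌋₊, 1 / Real.sqrt n ≤ X ^ η * (2 * Real.sqrt X) := by
        gcongr; linarith
    _ = 2 * X ^ (1 / 2 + η) := by
        rw [Real.rpow_add_of_nonneg hX (by norm_num) h0, ← Real.sqrt_eq_rpow]; ring

/-! ### The asymptotic formula -/

theorem tendsto_const_add_rpow_sub_linear_atBot {a β : ℝ} (ha : 0 < a) (hβ : β < 1) (c K : ℝ) :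
    Tendsto (fun L : ℝ => c + K * L ^ β - a * L) atTop atBot := by
  have h1 : Tendsto (fun L : ℝ => K * L ^ (-(1 - β)) - a) atTop (𝓝 (K * 0 - a)) :=
    ((tendsto_rpow_neg_atTop (by linarith)).const_mul K).sub_const a
  rw [mul_zero, zero_sub] at h1
  have h2 := tendsto_atBot_add_const_left atTop c
    (tendsto_id.atTop_mul_neg (by linarith : -a < 0) h1)
  refine h2.congr' ?_
  filter_upwards [eventually_gt_atTop 0] with L hL
  have : L ^ β = L * L ^ (-(1 - β)) := by
    nth_rewrite 2 [← Real.rpow_one L]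
    rw [← Real.rpow_add hL]
    ring_nf
  rw [this, id]
  ring

theorem phiStar_rpow_neg_le {q : ℕ} (hq : q ≠ 0) (h : 0 < phiStar q) {η : ℝ} (hη : 0 ≤ η) :
    (phiStar q : ℝ) ^ (-η) ≤ Real.exp (η / 2 * Real.log 12 - η / 2 * Real.log q) := by
  have hφ : (0 : ℝ) < phiStar q := by exact_mod_cast h
  have hq0 : (0 : ℝ) < q := by exact_mod_cast Nat.pos_of_ne_zero hq
  have h1 := Real.log_le_log hq0 (le_twelve_mul_phiStar_sq hq h)
  rw [Real.log_mul (by norm_num) (by positivity), Real.log_pow] at h1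
  push_cast at h1
  rw [Real.rpow_def_of_pos hφ]
  refine Real.exp_le_exp.2 ?_
  nlinarith

/-- The logarithm of the error bound is at most a constant plus K (log q)^β - (η/2) log q, and β <
1. -/
theorem tendsto_moment_sub_diagonalProd {δ k : ℝ} (hδ : 0 < δ) (hk : 0 ≤ k) {ι : Type*}
    {l : Filter ι} {X : ι → ℝ} {q : ι → ℕ} (hX : Tendsto X l atTop) (hq : Tendsto q l atTop)
    (hφ : ∀ᶠ i in l, 0 < phiStar (q i))
    (hXq : X =O[l] fun i => Real.log (q i) ^ (2 - δ)) :
    Tendsto (fun i => moment k (X i) (q i) - diagonalProd k ⌊X i⌋₊ (q i)) l (𝓝 0) := by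
  obtain ⟨C, hC0, hC⟩ := hXq.exists_pos
  -- As 2η ≤ δ/2, the exponent (2 - δ)(1/2 + η) is at most 1 - δη < 1; the cap 1/2 keeps η ≤ 1.
  set η := min (δ / 4) (1 / 2) with hη
  have hη0 : 0 < η := lt_min (by linarith) (by norm_num)
  have hη1 : η ≤ δ / 4 := min_le_left _ _
  have hη2 : η ≤ 1 / 2 := min_le_right _ _
  set β := (2 - δ) * (1 / 2 + η) with hβ
  have hβ1 : β < 1 := by nlinarith
  have hL : Tendsto (fun i => Real.log (q i)) l atTop :=
    Real.tendsto_log_atTop.comp (tendsto_natCast_atTop_atTop.comp hq)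
  -- In 4k, one factor 2 comes from the square and the other from the bound 2 X^(1/2+η).
  have hmain := Real.tendsto_exp_atBot.comp ((tendsto_const_add_rpow_sub_linear_atBot
    (by linarith : 0 < η / 2) hβ1 (η / 2 * Real.log 12) (4 * k * C ^ (1 / 2 + η))).comp hL)
  refine squeeze_zero_norm' ?_ hmain
  filter_upwards [hC.bound, hφ, hX.eventually_ge_atTop 0, hL.eventually_gt_atTop 0,
    hq.eventually_ne_atTop 0] with i hi hφi hXi hLi hqi
  have hLp : 0 < Real.log (q i) ^ (2 - δ) := Real.rpow_pos_of_pos hLi _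
  rw [Real.norm_of_nonneg hXi, Real.norm_of_nonneg hLp.le] at hi
  have hXpow : X i ^ (1 / 2 + η) ≤ C ^ (1 / 2 + η) * Real.log (q i) ^ β := by
    refine (Real.rpow_le_rpow hXi hi (by linarith)).trans (le_of_eq ?_)
    rw [Real.mul_rpow hC0.le hLp.le, ← Real.rpow_mul hLi.le]
  have hsum := sum_vonMangoldt_rpow_le hXi hη0.le
  rw [Real.norm_eq_abs]
  refine (abs_moment_sub_diagonalProd_le hk (X i) hqi hφi hη0.le (by linarith)).trans ?_
  simp only [Function.comp_apply]
  rw [← Real.exp_nat_mul]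
  refine (mul_le_mul_of_nonneg_right (phiStar_rpow_neg_le hqi hφi hη0.le)
    (Real.exp_pos _).le).trans ?_
  rw [← Real.exp_add]
  refine Real.exp_le_exp.2 ?_
  have h1 := mul_le_mul_of_nonneg_left (hsum.trans (mul_le_mul_of_nonneg_left hXpow
    (by norm_num : (0 : ℝ) ≤ 2))) hk
  push_cast
  nlinarith

/-- The diagonal is at least 1, so an additive error o(1) is also a relative one. -/
theorem isEquivalent_moment_diagonalProd {δ k : ℝ} (hδ : 0 < δ) (hk : 0 ≤ k) {ι : Type*}
    {l : Filter ι} {X : ι → ℝ} {q : ι → ℕ} (hX : Tendsto X l atTop) (hq : Tendsto q l atTop)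
    (hφ : ∀ᶠ i in l, 0 < phiStar (q i))
    (hXq : X =O[l] fun i => Real.log (q i) ^ (2 - δ)) :
    (fun i => moment k (X i) (q i)) ~[l] fun i => diagonalProd k ⌊X i⌋₊ (q i) := by
  refine ((isLittleO_one_iff ℝ).2
    (tendsto_moment_sub_diagonalProd hδ hk hX hq hφ hXq)).trans_isBigO ?_
  refine IsBigO.of_bound 1 (Eventually.of_forall fun i => ?_)
  rw [norm_one, one_mul, Real.norm_eq_abs]
  exact (one_le_diagonalProd hk _ _).trans (le_abs_self _)

end PrimitiveMoment

end

theorem theorem2 (δ k : ℝ) (hδ : 0 < δ) (hk : 0 ≤ k) :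
    (∀ p : ℕ, p.Prime →
      Summable fun m : ℕ => PrimitiveMoment.divisorFn k (p ^ m) ^ 2 / (p : ℝ) ^ m) ∧
    (Multipliable fun p : Nat.Primes =>
      (1 - 1 / ((p : ℕ) : ℝ)) ^ (k ^ 2) * PrimitiveMoment.localSum k p) ∧
    ∀ {ι : Type*} (l : Filter ι) (X : ι → ℝ) (q : ι → ℕ),
      Tendsto X l atTop → Tendsto q l atTop →
      (∀ᶠ i in l, 0 < PrimitiveMoment.phiStar (q i)) →
      (X =O[l] fun i => Real.log (q i) ^ (2 - δ)) →
      ((fun i => PrimitiveMoment.moment k (X i) (q i)) ~[l] fun i =>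
        PrimitiveMoment.arithConst k *
          (∏ p ∈ (q i).primeFactors with (p : ℕ) ≤ X i, (PrimitiveMoment.localSum k p)⁻¹) *
          (Real.exp Real.eulerMascheroniConstant * Real.log (X i)) ^ (k ^ 2)) ∧
      ((∀ ε : ℝ, 0 < ε →
          (fun i => ((q i).primeFactors.card : ℝ)) =O[l] fun i => X i ^ (1 + ε)) →
        (fun i => PrimitiveMoment.moment k (X i) (q i)) ~[l] fun i =>
          PrimitiveMoment.arithConst k *
            (∏ p ∈ (q i).primeFactors, (PrimitiveMoment.localSum k p)⁻¹) *
            (Real.exp Real.eulerMascheroniConstant * Real.log (X i)) ^ (k ^ 2)) := by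
  refine ⟨fun p hp => ?_, PrimitiveMoment.multipliable_arithFactor k, ?_⟩
  · simpa only [PrimitiveMoment.divisorFn_prime_pow k hp, PrimitiveMoment.divCoeff] using
      PrimitiveMoment.summable_divCoeff_sq k hp
  · intro ι l X q hX hq hφ hXq
    have h : (fun i => PrimitiveMoment.moment k (X i) (q i)) ~[l] fun i =>
        PrimitiveMoment.mainTerm k (X i) (q i) :=
      (PrimitiveMoment.isEquivalent_moment_diagonalProd hδ hk hX hq hφ hXq).trans
        (PrimitiveMoment.isEquivalent_diagonalProd_mainTerm hk hX (hq.eventually_ne_atTop 0))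
    exact ⟨h, fun hω =>
      h.trans (PrimitiveMoment.isEquivalent_mainTerm_of_card_primeFactors k hX hω)⟩
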